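/- Work over $\mathbb{C}$; all modules over Lie superalgebras are $\mathbb{Z}_2$-graded, submodules are graded, and isomorphisms are even. Let $\mathcal{R}$ be the $N=1$ Ramond algebra, the Lie superalgebra with basis $L_m, G_m$ ($m\in\mathbb{Z}$) and $C$, where $L_m, C$ are even and $G_m$ is odd, and with brackets $$[L_m,L_n]=(n-m)L_{m+n}+\tfrac{m^3-m}{12}\delta_{m+n,0}C,\quad [G_m,G_n]=-2L_{m+n}+\tfrac{4m^2-1}{12}\delta_{m+n,0}C,$$ $$[L_m,G_n]=\left(n-\tfrac m2\right)G_{m+n},\quad [\mathcal{R},C]=0 .$$ Let $\mathcal{R}_m=\mathrm{span}\{L_m,G_m,\delta_{m,0}C\}$. An $\mathcal{R}$-module is restricted if each of its vectors is annihilated by $\mathcal{R}_m$ for all sufficiently large $m$. Let $\mathcal{B}=\mathrm{span}\{L_m,G_m : m>0\}\oplus\mathbb{C}L_0\oplus\mathbb{C}C$, a subalgebra of $\mathcal{R}$. For a $\mathcal{B}$-module $V$ on which $C$ acts as the scalar $c$, put $\mathrm{Ind}_{\mathcal{B},c}(V)=U(\mathcal{R})\otimes_{U(\mathcal{B})}V$,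 where $U(\cdot)$ is the universal enveloping algebra. **Theorem 4.2.** Let $P$ be a simple restricted $\mathcal{R}$-module, and assume that there is an integer $k\ge 2$ such that $L_k$ acts injectively on $P$. Then $C$ acts on $P$ as a scalar $c\in\mathbb{C}$, and the following hold. (1) There is a smallest integer $b\ge k$ for which $$M_b=\{w\in P : L_m w=G_n w=0 \text{ for all } m>b,\ n>b-1\}$$ is nonzero, and $V:=M_b$ is a $\mathcal{B}$-module (a $\mathcal{B}$-submodule of $P$). (2) (i) If $b=k$, then $V$ is a simple $\mathcal{B}$-module and $P\cong\mathrm{Ind}_{\mathcal{B},c}(V)$ as $\mathcal{R}$-modules. (ii) If $b>k$ and $L_b$ acts injectively on $V$, then $V$ is a simple $\mathcal{B}$-module and $P\cong\mathrm{Ind}_{\mathcal{B},c}(V)$ as $\mathcal{R}$-modules. -/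

import Mathlib

open scoped TensorProduct

/-- The sign `(-1)^{|x||y|}` for homogeneous elements of parities `i` and `j`. -/
def koszulSign (i j : ZMod 2) : ℂ := (-1) ^ (i.val * j.val)

/-- A complex Lie superalgebra: a `ℤ₂`-graded vector space `𝔤 = 𝔤₀ ⊕ 𝔤₁` with an even bilinear
bracket that satisfies super skew-symmetry and the super Jacobi identity. -/
class LieSuperalgebra (𝔤 : Type*) [AddCommGroup 𝔤] [Module ℂ 𝔤] where
  part : ZMod 2 → Submodule ℂ 𝔤
  isCompl_part : IsCompl (part 0) (part 1)
  bracket : 𝔤 →ₗ[ℂ] 𝔤 →ₗ[ℂ] 𝔤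
  bracket_mem : ∀ {i j : ZMod 2} {x y : 𝔤}, x ∈ part i → y ∈ part j →
    bracket x y ∈ part (i + j)
  bracket_skew : ∀ {i j : ZMod 2} {x y : 𝔤}, x ∈ part i → y ∈ part j →
    bracket x y = -(koszulSign i j • bracket y x)
  jacobi : ∀ {i j : ZMod 2} {x y : 𝔤}, x ∈ part i → y ∈ part j → ∀ z : 𝔤,
    bracket x (bracket y z) = bracket (bracket x y) z + koszulSign i j • bracket y (bracket x z)

/-- A module over a Lie superalgebra `𝔤`: a `ℤ₂`-graded vector space `M = M₀ ⊕ M₁` with a bilinear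
action such that `𝔤_i M_j ⊆ M_{i+j}` and `x(yv) - (-1)^{|x||y|} y(xv) = [x,y]v`. -/
structure SuperModule (𝔤 : Type*) [AddCommGroup 𝔤] [Module ℂ 𝔤] [LieSuperalgebra 𝔤]
    (M : Type*) [AddCommGroup M] [Module ℂ M] where
  part : ZMod 2 → Submodule ℂ M
  isCompl_part : IsCompl (part 0) (part 1)
  act : 𝔤 →ₗ[ℂ] Module.End ℂ M
  act_mem : ∀ {i j : ZMod 2} {x : 𝔤} {v : M}, x ∈ LieSuperalgebra.part i → v ∈ part j →
    act x v ∈ part (i + j)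
  act_bracket : ∀ {i j : ZMod 2} {x y : 𝔤}, x ∈ LieSuperalgebra.part i →
    y ∈ LieSuperalgebra.part j → ∀ v : M,
    act x (act y v) - koszulSign i j • act y (act x v) = act (LieSuperalgebra.bracket x y) v

/-- `N` is a graded subspace with respect to the decomposition into `A 0` and `A 1`. -/
def IsGradedSubspace {M : Type*} [AddCommGroup M] [Module ℂ M] (A : ZMod 2 → Submodule ℂ M)
    (N : Submodule ℂ M) : Prop :=
  N ≤ (N ⊓ A 0) ⊔ (N ⊓ A 1)

theorem IsGradedSubspace.isCompl_comap {M : Type*} [AddCommGroup M] [Module ℂ M]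
    {A : ZMod 2 → Submodule ℂ M} {N : Submodule ℂ M} (hN : IsGradedSubspace A N)
    (h : IsCompl (A 0) (A 1)) :
    IsCompl ((A 0).comap N.subtype) ((A 1).comap N.subtype) := by
  constructor
  · rw [Submodule.disjoint_def]
    intro x h0 h1
    exact Subtype.ext (Submodule.disjoint_def.1 h.disjoint _ h0 h1)
  · rw [codisjoint_iff, eq_top_iff]
    rintro ⟨x, hx⟩ -
    obtain ⟨y, hy, z, hz, hyz⟩ := Submodule.mem_sup.1 (hN hx)
    exact Submodule.mem_sup.2 ⟨⟨y, hy.1⟩, hy.2, ⟨z, hz.1⟩, hz.2, Subtype.ext hyz⟩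

/-- The parity operator, `1` on `A 0` and `-1` on `A 1`. -/
noncomputable def parityOp {M : Type*} [AddCommGroup M] [Module ℂ M] {A : ZMod 2 → Submodule ℂ M}
    (h : IsCompl (A 0) (A 1)) : M →ₗ[ℂ] M :=
  LinearMap.ofIsCompl h (A 0).subtype (-(A 1).subtype)

theorem parityOp_apply {M : Type*} [AddCommGroup M] [Module ℂ M] {A : ZMod 2 → Submodule ℂ M}
    (h : IsCompl (A 0) (A 1)) {i : ZMod 2} {v : M} (hv : v ∈ A i) :
    parityOp h v = ((-1 : ℂ) ^ i.val) • v := by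
  fin_cases i
  · exact (LinearMap.ofIsCompl_apply_left h (⟨v, hv⟩ : A 0)).trans (by simp [ZMod.val])
  · exact (LinearMap.ofIsCompl_apply_right h (⟨v, hv⟩ : A 1)).trans (by simp [ZMod.val])

theorem neg_one_pow_val_add (i j : ZMod 2) :
    (-1 : ℂ) ^ (i + j).val = (-1) ^ i.val * (-1) ^ j.val := by
  rw [ZMod.val_add, ← pow_add, ← neg_one_pow_eq_pow_mod_two]

/-- A linear property holds for all vectors if it holds for the homogeneous ones. -/
theorem IsCompl.hom_induction {M : Type*} [AddCommGroup M] [Module ℂ M]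
    {A : ZMod 2 → Submodule ℂ M} (h : IsCompl (A 0) (A 1)) {p : M → Prop}
    (hA : ∀ i, ∀ v ∈ A i, p v) (hadd : ∀ v w, p v → p w → p (v + w)) (v : M) : p v := by
  have hv : v ∈ A 0 ⊔ A 1 := by rw [h.sup_eq_top]; trivial
  obtain ⟨y, hy, z, hz, rfl⟩ := Submodule.mem_sup.1 hv
  exact hadd _ _ (hA 0 y hy) (hA 1 z hz)

/-- A subalgebra of a Lie superalgebra: a graded subspace closed under the bracket. -/
structure LieSubSuperalgebra (𝔤 : Type*) [AddCommGroup 𝔤] [Module ℂ 𝔤] [LieSuperalgebra 𝔤] where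
  toSubmodule : Submodule ℂ 𝔤
  graded : IsGradedSubspace LieSuperalgebra.part toSubmodule
  bracket_mem : ∀ {x y : 𝔤}, x ∈ toSubmodule → y ∈ toSubmodule →
    LieSuperalgebra.bracket x y ∈ toSubmodule

section General

variable {𝔤 : Type*} [AddCommGroup 𝔤] [Module ℂ 𝔤] [LieSuperalgebra 𝔤]

/-- A subalgebra is itself a Lie superalgebra. -/
instance LieSubSuperalgebra.instLieSuperalgebra (𝔟 : LieSubSuperalgebra 𝔤) :
    LieSuperalgebra 𝔟.toSubmodule where
  part i := (LieSuperalgebra.part i).comap 𝔟.toSubmodule.subtype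
  isCompl_part := 𝔟.graded.isCompl_comap LieSuperalgebra.isCompl_part
  bracket := LinearMap.mk₂ ℂ
    (fun x y => ⟨LieSuperalgebra.bracket (x : 𝔤) (y : 𝔤), 𝔟.bracket_mem x.2 y.2⟩)
    (fun _ _ _ => Subtype.ext (by simp)) (fun _ _ _ => Subtype.ext (by simp))
    (fun _ _ _ => Subtype.ext (by simp)) (fun _ _ _ => Subtype.ext (by simp))
  bracket_mem hx hy := LieSuperalgebra.bracket_mem (𝔤 := 𝔤) hx hy
  bracket_skew hx hy := Subtype.ext (LieSuperalgebra.bracket_skew (𝔤 := 𝔤) hx hy)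
  jacobi hx hy z := Subtype.ext (LieSuperalgebra.jacobi (𝔤 := 𝔤) hx hy z)

namespace SuperModule

variable {M : Type*} [AddCommGroup M] [Module ℂ M]

/-- Restriction of a module to a subalgebra. -/
def restrict (ρ : SuperModule 𝔤 M) (𝔟 : LieSubSuperalgebra 𝔤) :
    SuperModule 𝔟.toSubmodule M where
  part := ρ.part
  isCompl_part := ρ.isCompl_part
  act := ρ.act ∘ₗ 𝔟.toSubmodule.subtype
  act_mem hx hv := ρ.act_mem hx hv
  act_bracket hx hy v := ρ.act_bracket hx hy v

/-- A (graded) submodule. -/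
structure IsSubmodule (ρ : SuperModule 𝔤 M) (N : Submodule ℂ M) : Prop where
  graded : IsGradedSubspace ρ.part N
  stable : ∀ (x : 𝔤), ∀ v ∈ N, ρ.act x v ∈ N

/-- The module structure on a submodule. -/
def sub (ρ : SuperModule 𝔤 M) {N : Submodule ℂ M} (hN : ρ.IsSubmodule N) : SuperModule 𝔤 N where
  part i := (ρ.part i).comap N.subtype
  isCompl_part := hN.graded.isCompl_comap ρ.isCompl_part
  act := LinearMap.mk₂ ℂ (fun x v => ⟨ρ.act x (v : M), hN.stable x v v.2⟩)
    (fun _ _ _ => Subtype.ext (by simp)) (fun _ _ _ => Subtype.ext (by simp))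
    (fun _ _ _ => Subtype.ext (by simp)) (fun _ _ _ => Subtype.ext (by simp))
  act_mem hx hv := ρ.act_mem hx hv
  act_bracket hx hy v := Subtype.ext (ρ.act_bracket hx hy v)

/-- A simple module: nonzero, and without graded submodules other than zero and itself. -/
structure IsSimple (ρ : SuperModule 𝔤 M) : Prop where
  nontrivial : Nontrivial M
  eq_bot_or_eq_top : ∀ N : Submodule ℂ M, ρ.IsSubmodule N → N = ⊥ ∨ N = ⊤

/-- Isomorphism of (graded) modules: a linear bijection that commutes with the action and
preserves the parity. -/
def Isomorphic {M' : Type*} [AddCommGroup M'] [Module ℂ M'] (ρ : SuperModule 𝔤 M)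
    (ρ' : SuperModule 𝔤 M') : Prop :=
  ∃ e : M ≃ₗ[ℂ] M', (∀ (x : 𝔤) (v : M), e (ρ.act x v) = ρ'.act x (e v)) ∧
    ∀ i : ZMod 2, (ρ.part i).map (e : M →ₗ[ℂ] M') = ρ'.part i

end SuperModule

variable (𝔤) in
/-- The relations `xy - (-1)^{|x||y|} yx = [x,y]` of the universal enveloping algebra. -/
inductive EnvelopingRel : TensorAlgebra ℂ 𝔤 → TensorAlgebra ℂ 𝔤 → Prop
  | mk {i j : ZMod 2} {x y : 𝔤} (hx : x ∈ LieSuperalgebra.part i)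
      (hy : y ∈ LieSuperalgebra.part j) :
      EnvelopingRel
        (TensorAlgebra.ι ℂ x * TensorAlgebra.ι ℂ y
          - koszulSign i j • (TensorAlgebra.ι ℂ y * TensorAlgebra.ι ℂ x))
        (TensorAlgebra.ι ℂ (LieSuperalgebra.bracket x y))

variable (𝔤) in
/-- The universal enveloping algebra `U(𝔤)` of a Lie superalgebra. -/
def Enveloping : Type _ := RingQuot (EnvelopingRel 𝔤)

noncomputable instance Enveloping.instRing : Ring (Enveloping 𝔤) :=
  inferInstanceAs (Ring (RingQuot (EnvelopingRel 𝔤)))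

noncomputable instance Enveloping.instAlgebra : Algebra ℂ (Enveloping 𝔤) :=
  inferInstanceAs (Algebra ℂ (RingQuot (EnvelopingRel 𝔤)))

namespace Enveloping

variable (𝔤) in
/-- The quotient map from the tensor algebra. -/
noncomputable def mk : TensorAlgebra ℂ 𝔤 →ₐ[ℂ] Enveloping 𝔤 :=
  RingQuot.mkAlgHom ℂ (EnvelopingRel 𝔤)

/-- The canonical map `𝔤 → U(𝔤)`. -/
noncomputable def ι : 𝔤 →ₗ[ℂ] Enveloping 𝔤 :=
  (mk 𝔤).toLinearMap ∘ₗ TensorAlgebra.ι ℂ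

theorem ι_rel {i j : ZMod 2} {x y : 𝔤} (hx : x ∈ LieSuperalgebra.part i)
    (hy : y ∈ LieSuperalgebra.part j) :
    ι x * ι y - koszulSign i j • (ι y * ι x) = ι (LieSuperalgebra.bracket x y) := by
  have : mk 𝔤 _ = mk 𝔤 _ := RingQuot.mkAlgHom_rel ℂ (EnvelopingRel.mk hx hy)
  simp only [map_sub, map_mul, map_smul] at this
  exact this

/-- The universal property of `U(𝔤)`. -/
noncomputable def lift {A : Type*} [Ring A] [Algebra ℂ A] (f : 𝔤 →ₗ[ℂ] A)
    (hf : ∀ (i j : ZMod 2) (x y : 𝔤), x ∈ LieSuperalgebra.part i → y ∈ LieSuperalgebra.part j →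
      f x * f y - koszulSign i j • (f y * f x) = f (LieSuperalgebra.bracket x y)) :
    Enveloping 𝔤 →ₐ[ℂ] A :=
  RingQuot.liftAlgHom ℂ ⟨TensorAlgebra.lift ℂ f, by
    rintro _ _ ⟨hx, hy⟩
    simpa using hf _ _ _ _ hx hy⟩

theorem lift_ι {A : Type*} [Ring A] [Algebra ℂ A] (f : 𝔤 →ₗ[ℂ] A)
    (hf : ∀ (i j : ZMod 2) (x y : 𝔤), x ∈ LieSuperalgebra.part i → y ∈ LieSuperalgebra.part j →
      f x * f y - koszulSign i j • (f y * f x) = f (LieSuperalgebra.bracket x y)) (x : 𝔤) :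
    lift f hf (ι x) = f x :=
  (RingQuot.liftAlgHom_mkAlgHom_apply ℂ _ _ _).trans (TensorAlgebra.lift_ι_apply f x)

theorem induction {p : Enveloping 𝔤 → Prop} (h0 : ∀ r : ℂ, p (algebraMap ℂ _ r))
    (h1 : ∀ x : 𝔤, p (ι x)) (hm : ∀ a b, p a → p b → p (a * b))
    (ha : ∀ a b, p a → p b → p (a + b)) (u : Enveloping 𝔤) : p u := by
  obtain ⟨t, rfl⟩ : ∃ t, mk 𝔤 t = u := RingQuot.mkAlgHom_surjective ℂ (EnvelopingRel 𝔤) u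
  induction t using TensorAlgebra.induction with
  | algebraMap r => rw [AlgHom.commutes]; exact h0 r
  | ι x => exact h1 x
  | mul a b iha ihb => rw [map_mul]; exact hm _ _ iha ihb
  | add a b iha ihb => rw [map_add]; exact ha _ _ iha ihb

variable (𝔤) in
/-- The part of parity `i` of `U(𝔤)`: the span of the products `x₁ ⋯ xₙ` of homogeneous elements
of `𝔤` with `|x₁| + ⋯ + |xₙ| = i`. -/
noncomputable def part (i : ZMod 2) : Submodule ℂ (Enveloping 𝔤) :=
  Submodule.span ℂ {u | ∃ l : List (ZMod 2 × 𝔤), (∀ p ∈ l, p.2 ∈ LieSuperalgebra.part p.1) ∧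
    (l.map Prod.fst).sum = i ∧ (l.map fun p => ι p.2).prod = u}

/-- The homomorphism `U(𝔟) → U(𝔤)` induced by the inclusion of a subalgebra. -/
noncomputable def incl (𝔟 : LieSubSuperalgebra 𝔤) :
    Enveloping 𝔟.toSubmodule →ₐ[ℂ] Enveloping 𝔤 :=
  lift (ι ∘ₗ 𝔟.toSubmodule.subtype) fun _ _ _ _ hx hy => ι_rel (𝔤 := 𝔤) hx hy

end Enveloping

/-- The action of `U(𝔤)` on a `𝔤`-module. -/
noncomputable def SuperModule.envAct {M : Type*} [AddCommGroup M] [Module ℂ M]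
    (ρ : SuperModule 𝔤 M) : Enveloping 𝔤 →ₐ[ℂ] Module.End ℂ M :=
  Enveloping.lift ρ.act fun _ _ _ _ hx hy => LinearMap.ext fun v => by
    simpa using ρ.act_bracket hx hy v

section Induced

variable (𝔟 : LieSubSuperalgebra 𝔤) {V : Type*} [AddCommGroup V] [Module ℂ V]
  (σ : SuperModule 𝔟.toSubmodule V)

/-- The span of the elements `u x ⊗ v - u ⊗ x v` of `U(𝔤) ⊗_ℂ V`, where `x` is in `U(𝔟)`. -/
noncomputable def balancedRel : Submodule ℂ (Enveloping 𝔤 ⊗[ℂ] V) :=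
  Submodule.span ℂ {t | ∃ (u : Enveloping 𝔤) (x : Enveloping 𝔟.toSubmodule) (v : V),
    t = (u * Enveloping.incl 𝔟 x) ⊗ₜ[ℂ] v - u ⊗ₜ[ℂ] (σ.envAct x v)}

/-- The space `U(𝔤) ⊗_{U(𝔟)} V`. -/
abbrev IndSpace : Type _ := (Enveloping 𝔤 ⊗[ℂ] V) ⧸ balancedRel 𝔟 σ

/-- The part of parity `i` of `U(𝔤) ⊗_{U(𝔟)} V`: the span of the `u ⊗ v` with `u`, `v`
homogeneous and `|u| + |v| = i`. -/
noncomputable def indPart (i : ZMod 2) : Submodule ℂ (IndSpace 𝔟 σ) :=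
  Submodule.span ℂ {t | ∃ (a c : ZMod 2) (u : Enveloping 𝔤) (v : V),
    u ∈ Enveloping.part 𝔤 a ∧ v ∈ σ.part c ∧ a + c = i ∧
      t = (balancedRel 𝔟 σ).mkQ (u ⊗ₜ[ℂ] v)}

/-- Left multiplication by `u` on `U(𝔤) ⊗_{U(𝔟)} V`. -/
noncomputable def indMul (u : Enveloping 𝔤) : Module.End ℂ (IndSpace 𝔟 σ) :=
  (balancedRel 𝔟 σ).mapQ (balancedRel 𝔟 σ) (LinearMap.rTensor V (LinearMap.mulLeft ℂ u)) (by
    rw [balancedRel, Submodule.span_le]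
    rintro _ ⟨w, x, v, rfl⟩
    refine Submodule.subset_span ⟨u * w, x, v, ?_⟩
    simp [mul_assoc])

theorem indMul_mk (u w : Enveloping 𝔤) (v : V) :
    indMul 𝔟 σ u ((balancedRel 𝔟 σ).mkQ (w ⊗ₜ[ℂ] v)) =
      (balancedRel 𝔟 σ).mkQ ((u * w) ⊗ₜ[ℂ] v) := by
  simp [indMul]

theorem indSpace_ext {W : Type*} [AddCommGroup W] [Module ℂ W] {f g : IndSpace 𝔟 σ →ₗ[ℂ] W}
    (h : ∀ u v, f ((balancedRel 𝔟 σ).mkQ (u ⊗ₜ[ℂ] v)) = g ((balancedRel 𝔟 σ).mkQ (u ⊗ₜ[ℂ] v))) :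
    f = g :=
  Submodule.linearMap_qext _ (TensorProduct.ext' h)

/-- Left multiplication as a linear map on `U(𝔤)`. -/
noncomputable def indMulHom : Enveloping 𝔤 →ₗ[ℂ] Module.End ℂ (IndSpace 𝔟 σ) where
  toFun := indMul 𝔟 σ
  map_add' a b := indSpace_ext 𝔟 σ fun u v => by
    rw [LinearMap.add_apply]
    simp only [indMul_mk, add_mul, TensorProduct.add_tmul, map_add]
  map_smul' r a := indSpace_ext 𝔟 σ fun u v => by
    rw [RingHom.id_apply, LinearMap.smul_apply]
    simp only [indMul_mk, smul_mul_assoc, ← TensorProduct.smul_tmul', map_smul]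

theorem SuperModule.envAct_ι {𝔨 M : Type*} [AddCommGroup 𝔨] [Module ℂ 𝔨] [LieSuperalgebra 𝔨]
    [AddCommGroup M] [Module ℂ M] (ρ : SuperModule 𝔨 M) (x : 𝔨) :
    ρ.envAct (Enveloping.ι x) = ρ.act x :=
  Enveloping.lift_ι _ _ x

theorem Enveloping.incl_ι (x : 𝔟.toSubmodule) : incl 𝔟 (ι x) = ι (x : 𝔤) :=
  Enveloping.lift_ι _ _ x

theorem Enveloping.ι_mem_part {i : ZMod 2} {x : 𝔤} (hx : x ∈ LieSuperalgebra.part i) :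
    ι x ∈ part 𝔤 i :=
  Submodule.subset_span ⟨[(i, x)], by simpa using hx, by simp, by simp⟩

theorem Enveloping.mul_mem_part {i j k : ZMod 2} {u w : Enveloping 𝔤} (hu : u ∈ part 𝔤 i)
    (hw : w ∈ part 𝔤 j) (hk : i + j = k) : u * w ∈ part 𝔤 k := by
  subst hk
  have h : part 𝔤 i * part 𝔤 j ≤ part 𝔤 (i + j) := by
    rw [part, part, Submodule.span_mul_span, Submodule.span_le]
    rintro _ ⟨_, ⟨l, hl, rfl, rfl⟩, _, ⟨l', hl', rfl, rfl⟩, rfl⟩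
    refine Submodule.subset_span ⟨l ++ l', ?_, by simp, by simp⟩
    intro p hp
    rcases List.mem_append.1 hp with hp | hp
    exacts [hl p hp, hl' p hp]
  exact h (Submodule.mul_mem_mul hu hw)

theorem Enveloping.exists_parts (u : Enveloping 𝔤) :
    ∃ a ∈ part 𝔤 0, ∃ b ∈ part 𝔤 1, a + b = u := by
  induction u using Enveloping.induction with
  | h0 r =>
    refine ⟨algebraMap ℂ _ r, ?_, 0, zero_mem _, add_zero _⟩
    rw [Algebra.algebraMap_eq_smul_one]
    exact Submodule.smul_mem _ _ (Submodule.subset_span ⟨[], by simp, by simp, by simp⟩)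
  | h1 x =>
    have hx : x ∈ LieSuperalgebra.part (𝔤 := 𝔤) 0 ⊔ LieSuperalgebra.part 1 := by
      rw [LieSuperalgebra.isCompl_part.sup_eq_top]; trivial
    obtain ⟨y, hy, z, hz, rfl⟩ := Submodule.mem_sup.1 hx
    exact ⟨ι y, ι_mem_part hy, ι z, ι_mem_part hz, (map_add _ _ _).symm⟩
  | hm _ _ iha ihb =>
    obtain ⟨a, ha, b, hb, rfl⟩ := iha
    obtain ⟨c, hc, d, hd, rfl⟩ := ihb
    refine ⟨a * c + b * d, ?_, a * d + b * c, ?_, ?_⟩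
    · exact add_mem (mul_mem_part ha hc (by decide)) (mul_mem_part hb hd (by decide))
    · exact add_mem (mul_mem_part ha hd (by decide)) (mul_mem_part hb hc (by decide))
    · rw [add_mul, mul_add, mul_add]
      abel
  | ha _ _ iha ihb =>
    obtain ⟨a, ha, b, hb, rfl⟩ := iha
    obtain ⟨c, hc, d, hd, rfl⟩ := ihb
    exact ⟨a + c, add_mem ha hc, b + d, add_mem hb hd, add_add_add_comm _ _ _ _⟩

variable (𝔤) in
/-- The parity automorphism of `U(𝔤)`. -/
noncomputable def Enveloping.parityHom : Enveloping 𝔤 →ₐ[ℂ] Enveloping 𝔤 :=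
  lift (ι ∘ₗ parityOp LieSuperalgebra.isCompl_part) fun i j x y hx hy => by
    simp only [LinearMap.comp_apply, parityOp_apply _ hx, parityOp_apply _ hy,
      parityOp_apply _ (LieSuperalgebra.bracket_mem hx hy), map_smul, ← ι_rel hx hy,
      neg_one_pow_val_add, smul_mul_smul_comm, smul_sub, smul_smul]
    congr 2
    ring

theorem Enveloping.parityHom_ι (x : 𝔤) :
    parityHom 𝔤 (ι x) = ι (parityOp LieSuperalgebra.isCompl_part x) :=
  lift_ι _ _ x

theorem Enveloping.parityHom_apply {i : ZMod 2} {u : Enveloping 𝔤} (hu : u ∈ part 𝔤 i) :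
    parityHom 𝔤 u = ((-1 : ℂ) ^ i.val) • u := by
  induction hu using Submodule.span_induction with
  | zero => simp
  | add a b _ _ iha ihb => rw [map_add, iha, ihb, smul_add]
  | smul r a _ iha => rw [map_smul, iha, smul_comm]
  | mem u hu =>
    obtain ⟨l, hl, rfl, rfl⟩ := hu
    induction l with
    | nil => simp
    | cons p l ih =>
      have h1 := hl p (by simp)
      have h2 := ih fun q hq => hl q (by simp [hq])
      simp only [List.map_cons, List.prod_cons, List.sum_cons, map_mul, h2, parityHom_ι,
        parityOp_apply _ h1, map_smul, smul_mul_smul_comm, neg_one_pow_val_add]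

theorem Enveloping.parityHom_incl (x : Enveloping 𝔟.toSubmodule) :
    parityHom 𝔤 (incl 𝔟 x) = incl 𝔟 (parityHom _ x) := by
  induction x using Enveloping.induction with
  | h0 r => simp only [AlgHom.commutes]
  | hm a b iha ihb => simp only [map_mul, iha, ihb]
  | ha a b iha ihb => simp only [map_add, iha, ihb]
  | h1 x =>
    rw [incl_ι, parityHom_ι, parityHom_ι, incl_ι]
    congr 1
    refine IsCompl.hom_induction (M := 𝔟.toSubmodule) (A := LieSuperalgebra.part)
      LieSuperalgebra.isCompl_part
      (p := fun x => parityOp LieSuperalgebra.isCompl_part (x : 𝔤) =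
        (parityOp LieSuperalgebra.isCompl_part x : 𝔟.toSubmodule)) ?_ ?_ x
    · intro i v hv
      have hv' : (v : 𝔤) ∈ LieSuperalgebra.part i := hv
      rw [parityOp_apply _ hv, parityOp_apply _ hv', Submodule.coe_smul]
    · intro v w hv hw
      simp only [Submodule.coe_add, map_add, hv, hw]

theorem SuperModule.parityOp_envAct {𝔨 M : Type*} [AddCommGroup 𝔨] [Module ℂ 𝔨]
    [LieSuperalgebra 𝔨] [AddCommGroup M] [Module ℂ M] (ρ : SuperModule 𝔨 M) (x : Enveloping 𝔨) :
    ∀ v : M, parityOp ρ.isCompl_part (ρ.envAct x v) =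
      ρ.envAct (Enveloping.parityHom 𝔨 x) (parityOp ρ.isCompl_part v) := by
  induction x using Enveloping.induction with
  | h0 r => intro v; simp [AlgHom.commutes]
  | hm a b iha ihb => intro v; simp only [map_mul, Module.End.mul_apply, iha, ihb]
  | ha a b iha ihb => intro v; simp only [map_add, LinearMap.add_apply, iha, ihb]
  | h1 x =>
    intro v
    rw [Enveloping.parityHom_ι, envAct_ι, envAct_ι]
    refine IsCompl.hom_induction (A := LieSuperalgebra.part) LieSuperalgebra.isCompl_part
      (p := fun x => parityOp ρ.isCompl_part (ρ.act x v) =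
        ρ.act (parityOp LieSuperalgebra.isCompl_part x) (parityOp ρ.isCompl_part v)) ?_ ?_ x
    · intro i x hx
      refine IsCompl.hom_induction (A := ρ.part) ρ.isCompl_part
        (p := fun v => parityOp ρ.isCompl_part (ρ.act x v) =
          ρ.act (parityOp LieSuperalgebra.isCompl_part x) (parityOp ρ.isCompl_part v)) ?_ ?_ v
      · intro j v hv
        rw [parityOp_apply _ hx, parityOp_apply _ hv, parityOp_apply _ (ρ.act_mem hx hv),
          neg_one_pow_val_add]
        simp only [map_smul, LinearMap.smul_apply, smul_smul, mul_comm]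
      · intro v w hv hw
        simp only [map_add, hv, hw]
    · intro x y hx hy
      simp only [map_add, LinearMap.add_apply, hx, hy]

/-- The parity operator of `U(𝔤) ⊗_{U(𝔟)} V`. -/
noncomputable def indParity : Module.End ℂ (IndSpace 𝔟 σ) :=
  (balancedRel 𝔟 σ).mapQ (balancedRel 𝔟 σ)
    (TensorProduct.map (Enveloping.parityHom 𝔤).toLinearMap (parityOp σ.isCompl_part)) (by
      rw [balancedRel, Submodule.span_le]
      rintro _ ⟨u, x, v, rfl⟩
      refine Submodule.subset_span ⟨Enveloping.parityHom 𝔤 u, Enveloping.parityHom _ x,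
        parityOp σ.isCompl_part v, ?_⟩
      simp [Enveloping.parityHom_incl, SuperModule.parityOp_envAct])

theorem indParity_apply {i : ZMod 2} {t : IndSpace 𝔟 σ} (ht : t ∈ indPart 𝔟 σ i) :
    indParity 𝔟 σ t = ((-1 : ℂ) ^ i.val) • t := by
  induction ht using Submodule.span_induction with
  | zero => simp
  | add a b _ _ iha ihb => rw [map_add, iha, ihb, smul_add]
  | smul r a _ iha => rw [map_smul, iha, smul_comm]
  | mem t ht =>
    obtain ⟨a, c, u, v, hu, hv, rfl, rfl⟩ := ht
    have h : indParity 𝔟 σ ((balancedRel 𝔟 σ).mkQ (u ⊗ₜ[ℂ] v)) =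
      (balancedRel 𝔟 σ).mkQ (Enveloping.parityHom 𝔤 u ⊗ₜ[ℂ] parityOp σ.isCompl_part v) := rfl
    rw [h, Enveloping.parityHom_apply hu, parityOp_apply _ hv, TensorProduct.smul_tmul_smul,
      map_smul, neg_one_pow_val_add]

theorem isCompl_indPart : IsCompl (indPart 𝔟 σ 0) (indPart 𝔟 σ 1) := by
  constructor
  · rw [Submodule.disjoint_def]
    intro t h0 h1
    have h := (indParity_apply 𝔟 σ h0).symm.trans (indParity_apply 𝔟 σ h1)
    simpa [ZMod.val_one, eq_neg_iff_add_eq_zero, ← two_smul ℂ] using h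
  · rw [codisjoint_iff, eq_top_iff]
    rintro t -
    obtain ⟨t, rfl⟩ := Submodule.mkQ_surjective _ t
    induction t using TensorProduct.induction_on with
    | zero => rw [map_zero]; exact zero_mem _
    | add a b iha ihb => rw [map_add]; exact add_mem iha ihb
    | tmul u v =>
      obtain ⟨a, ha, b, hb, rfl⟩ := Enveloping.exists_parts u
      refine IsCompl.hom_induction (A := σ.part) σ.isCompl_part
        (p := fun v => (balancedRel 𝔟 σ).mkQ ((a + b) ⊗ₜ[ℂ] v) ∈
          indPart 𝔟 σ 0 ⊔ indPart 𝔟 σ 1) ?_ ?_ v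
      · intro i v hv
        have key : ∀ j, ∀ t ∈ indPart 𝔟 σ j, t ∈ indPart 𝔟 σ 0 ⊔ indPart 𝔟 σ 1 := by
          intro j
          fin_cases j
          exacts [fun t ht => Submodule.mem_sup_left ht, fun t ht => Submodule.mem_sup_right ht]
        rw [TensorProduct.add_tmul, map_add]
        exact add_mem (key _ _ (Submodule.subset_span ⟨0, i, a, v, ha, hv, rfl, rfl⟩))
          (key _ _ (Submodule.subset_span ⟨1, i, b, v, hb, hv, rfl, rfl⟩))
      · intro v w hv hw
        rw [TensorProduct.tmul_add, map_add]
        exact add_mem hv hw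

/-- The induced module `Ind(V) = U(𝔤) ⊗_{U(𝔟)} V`, on which `𝔤` acts by left multiplication. -/
noncomputable def SuperModule.ind : SuperModule 𝔤 (IndSpace 𝔟 σ) where
  part := indPart 𝔟 σ
  isCompl_part := isCompl_indPart 𝔟 σ
  act := indMulHom 𝔟 σ ∘ₗ Enveloping.ι
  act_mem {i j x t} hx ht := by
    induction ht using Submodule.span_induction with
    | zero => rw [map_zero]; exact zero_mem _
    | add a b _ _ iha ihb => rw [map_add]; exact add_mem iha ihb
    | smul r a _ iha => rw [map_smul]; exact Submodule.smul_mem _ _ iha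
    | mem t ht =>
      obtain ⟨a, c, u, v, hu, hv, rfl, rfl⟩ := ht
      exact Submodule.subset_span ⟨i + a, c, Enveloping.ι x * u, v,
        Enveloping.mul_mem_part (Enveloping.ι_mem_part hx) hu rfl, hv, add_assoc _ _ _,
        indMul_mk 𝔟 σ _ _ _⟩
  act_bracket {i j x y} hx hy t := by
    have h : ∀ a b, indMul 𝔟 σ (a * b) = indMul 𝔟 σ a ∘ₗ indMul 𝔟 σ b := fun a b =>
      indSpace_ext 𝔟 σ fun u v => by
        rw [LinearMap.comp_apply]; simp only [indMul_mk, mul_assoc]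
    have h2 := congrArg (fun u => indMulHom 𝔟 σ u t) (Enveloping.ι_rel hx hy)
    simp only [map_sub, map_smul, LinearMap.sub_apply, LinearMap.smul_apply] at h2
    refine Eq.trans ?_ h2
    exact congrArg₂ (fun p q => p - koszulSign i j • q)
      (LinearMap.congr_fun (h _ _) t).symm (LinearMap.congr_fun (h _ _) t).symm

end Induced

end General

/-- The indices of the basis `L_m`, `G_m` (`m ∈ ℤ`), `C` of the `N = 1` Ramond algebra. -/
inductive RamondIndex : Type
  | L (m : ℤ)
  | G (m : ℤ)
  | C

/-- The underlying vector space of the `N = 1` Ramond algebra, with basis `L_m`, `G_m`, `C`. -/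
abbrev Ramond : Type := RamondIndex →₀ ℂ

namespace Ramond

noncomputable def L (m : ℤ) : Ramond := Finsupp.single (.L m) 1

noncomputable def G (m : ℤ) : Ramond := Finsupp.single (.G m) 1

noncomputable def C : Ramond := Finsupp.single .C 1

/-- `L_m` and `C` are even, `G_m` is odd. -/
def parity : RamondIndex → ZMod 2
  | .L _ => 0
  | .G _ => 1
  | .C => 0

/-- The brackets of the basis elements:
`[L_m, L_n] = (n - m) L_{m+n} + (m³ - m)/12 δ_{m+n,0} C`,
`[G_m, G_n] = -2 L_{m+n} + (4m² - 1)/12 δ_{m+n,0} C`,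
`[L_m, G_n] = (n - m/2) G_{m+n}`, and `C` is central. -/
noncomputable def basisBracket : RamondIndex → RamondIndex → Ramond
  | .L m, .L n => ((n : ℂ) - m) • L (m + n) + (if m + n = 0 then ((m : ℂ) ^ 3 - m) / 12 else 0) • C
  | .G m, .G n => (-2 : ℂ) • L (m + n) + (if m + n = 0 then (4 * (m : ℂ) ^ 2 - 1) / 12 else 0) • C
  | .L m, .G n => ((n : ℂ) - m / 2) • G (m + n)
  | .G m, .L n => -(((m : ℂ) - n / 2) • G (n + m))
  | .C, _ => 0
  | _, .C => 0

/-- The bilinear extension of `basisBracket`. -/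
noncomputable def bracket : Ramond →ₗ[ℂ] Ramond →ₗ[ℂ] Ramond :=
  Finsupp.linearCombination ℂ fun a => Finsupp.linearCombination ℂ (basisBracket a)

/-- The even part is the span of the `L_m` and `C`, the odd part the span of the `G_m`. -/
noncomputable def part (i : ZMod 2) : Submodule ℂ Ramond :=
  Submodule.span ℂ {x | ∃ a, parity a = i ∧ x = Finsupp.single a 1}

theorem bracket_single (a b : RamondIndex) :
    bracket (Finsupp.single a 1) (Finsupp.single b 1) = basisBracket a b := by
  simp [bracket]

theorem part_eq (i : ZMod 2) : part i = Finsupp.supported ℂ ℂ {a | parity a = i} := by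
  rw [Finsupp.supported_eq_span_single, part]
  congr 1
  ext x
  simp [eq_comm]

theorem isCompl_part : IsCompl (part 0) (part 1) := by
  rw [part_eq, part_eq]
  constructor
  · rw [Finsupp.disjoint_supported_supported_iff, Set.disjoint_left]
    intro a h0 h1
    simp only [Set.mem_ofPred_eq] at h0 h1
    rw [h0] at h1
    exact absurd h1 (by decide)
  · rw [codisjoint_iff, ← Finsupp.supported_union, eq_top_iff]
    intro x _
    rw [Finsupp.mem_supported]
    rintro a -
    cases a <;> simp [parity]

theorem single_mem_part (a : RamondIndex) : (Finsupp.single a 1 : Ramond) ∈ part (parity a) :=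
  Submodule.subset_span ⟨a, rfl, rfl⟩

theorem basisBracket_mem (a b : RamondIndex) : basisBracket a b ∈ part (parity a + parity b) := by
  have hL : ∀ m, L m ∈ part 0 := fun m => single_mem_part (.L m)
  have hG : ∀ m, G m ∈ part 1 := fun m => single_mem_part (.G m)
  have hC : C ∈ part 0 := single_mem_part .C
  have h : ∀ {x : Ramond} {i j : ZMod 2}, x ∈ part i → i = j → x ∈ part j := by
    rintro x i _ hx rfl
    exact hx
  rcases a with m | m | _ <;> rcases b with n | n | _ <;>
    simp only [basisBracket, zero_mem, parity]
  · exact h (add_mem (Submodule.smul_mem _ _ (hL _)) (Submodule.smul_mem _ _ hC)) (by decide)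
  · exact h (Submodule.smul_mem _ _ (hG _)) (by decide)
  · exact h (neg_mem (Submodule.smul_mem _ _ (hG _))) (by decide)
  · exact h (add_mem (Submodule.smul_mem _ _ (hL _)) (Submodule.smul_mem _ _ hC)) (by decide)

theorem basisBracket_skew (a b : RamondIndex) :
    basisBracket a b = -(koszulSign (parity a) (parity b) • basisBracket b a) := by
  rcases a with m | m | _ <;> rcases b with n | n | _ <;>
    simp only [basisBracket, parity, koszulSign, ZMod.val_zero, ZMod.val_one, mul_zero,
      mul_one, pow_zero, pow_one, one_smul, smul_zero, neg_zero, neg_smul, neg_neg]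
  · rw [add_comm n m]
    split_ifs with h
    · obtain rfl : n = -m := by omega
      push_cast
      module
    · module
  · rw [add_comm n m]
    split_ifs with h
    · obtain rfl : n = -m := by omega
      push_cast
      module
    · module

theorem basis_jacobi (a b c : RamondIndex) :
    bracket (Finsupp.single a 1) (basisBracket b c) =
      bracket (basisBracket a b) (Finsupp.single c 1) +
        koszulSign (parity a) (parity b) • bracket (Finsupp.single b 1) (basisBracket a c) := by
  rcases a with m | m | _ <;> rcases b with n | n | _ <;> rcases c with p | p | _ <;>
    simp only [basisBracket, parity, koszulSign, ZMod.val_zero, ZMod.val_one, mul_zero,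
      mul_one, pow_zero, pow_one, one_smul, smul_zero, neg_smul, L, G, C, map_add,
      map_smul, map_neg, map_zero, LinearMap.add_apply, LinearMap.smul_apply, LinearMap.neg_apply,
      LinearMap.zero_apply, bracket_single, add_zero, neg_zero]
  all_goals try obtain ⟨s, hs⟩ : ∃ s : ℤ, m + n + p = s := ⟨_, rfl⟩
  all_goals try
    simp only [hs, show m + (n + p) = s by omega, show n + (m + p) = s by omega,
      show p + (m + n) = s by omega, show m + (p + n) = s by omega,
      show n + (p + m) = s by omega, show p + (n + m) = s by omega, show n + p + m = s by omega,
      show n + m + p = s by omega, show m + p + n = s by omega]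
  all_goals try obtain rfl : p = s - m - n := by omega
  all_goals first
    | (split_ifs with h
       · subst h
         push_cast
         module
       · push_cast
         module)
    | (push_cast; module)

/-- A linear property holds on `part i` if it holds for the basis elements of parity `i`. -/
theorem part_induction {i : ZMod 2} {p : Ramond → Prop}
    (hb : ∀ a, parity a = i → p (Finsupp.single a 1)) (hz : p 0)
    (ha : ∀ x y, p x → p y → p (x + y)) (hs : ∀ (r : ℂ) (x), p x → p (r • x))
    {x : Ramond} (hx : x ∈ part i) : p x := by
  induction hx using Submodule.span_induction with
  | mem x hx =>
    obtain ⟨a, h, rfl⟩ := hx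
    exact hb a h
  | zero => exact hz
  | add x y _ _ h1 h2 => exact ha x y h1 h2
  | smul r x _ h => exact hs r x h

noncomputable instance instLieSuperalgebra : LieSuperalgebra Ramond where
  part := part
  isCompl_part := isCompl_part
  bracket := bracket
  bracket_mem {i j x y} hx hy := by
    refine part_induction (p := fun x => bracket x y ∈ part (i + j)) ?_ ?_ ?_ ?_ hx
    · rintro a rfl
      refine part_induction (p := fun y => bracket _ y ∈ part (parity a + j)) ?_ ?_ ?_ ?_ hy
      · rintro b rfl
        rw [bracket_single]
        exact basisBracket_mem a b
      · rw [map_zero]; exact zero_mem _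
      · intro x y h1 h2; rw [map_add]; exact add_mem h1 h2
      · intro r x h; rw [map_smul]; exact Submodule.smul_mem _ _ h
    · rw [map_zero]; exact zero_mem _
    · intro x y h1 h2; rw [map_add]; exact add_mem h1 h2
    · intro r x h; rw [map_smul]; exact Submodule.smul_mem _ _ h
  bracket_skew {i j x y} hx hy := by
    refine part_induction (p := fun x => bracket x y = -(koszulSign i j • bracket y x))
      ?_ ?_ ?_ ?_ hx
    · rintro a rfl
      refine part_induction (p := fun y => bracket (Finsupp.single a 1) y =
        -(koszulSign (parity a) j • bracket y (Finsupp.single a 1))) ?_ ?_ ?_ ?_ hy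
      · rintro b rfl
        rw [bracket_single, bracket_single]
        exact basisBracket_skew a b
      · simp
      · intro x y h1 h2
        simp only [map_add, LinearMap.add_apply, h1, h2, smul_add, neg_add]
      · intro r x h
        simp only [map_smul, LinearMap.smul_apply, h, smul_neg, smul_comm r]
    · simp
    · intro x y h1 h2
      simp only [map_add, LinearMap.add_apply, h1, h2, smul_add, neg_add]
    · intro r x h
      simp only [map_smul, LinearMap.smul_apply, h, smul_neg, smul_comm r]
  jacobi {i j x y} hx hy z := by
    refine part_induction (p := fun x => bracket x (bracket y z) =
      bracket (bracket x y) z + koszulSign i j • bracket y (bracket x z)) ?_ ?_ ?_ ?_ hx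
    · rintro a rfl
      refine part_induction (p := fun y => bracket (Finsupp.single a 1) (bracket y z) =
        bracket (bracket (Finsupp.single a 1) y) z +
          koszulSign (parity a) j • bracket y (bracket (Finsupp.single a 1) z)) ?_ ?_ ?_ ?_ hy
      · rintro b rfl
        induction z using Finsupp.induction_linear with
        | zero => simp
        | add z w h1 h2 =>
          simp only [map_add, h1, h2, smul_add]
          abel
        | single c r =>
          rw [← mul_one r, ← smul_eq_mul, ← Finsupp.smul_single]
          simp only [map_smul, bracket_single, basis_jacobi a b c, smul_add, smul_comm r]
      · simp
      · intro x y h1 h2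
        simp only [map_add, LinearMap.add_apply, h1, h2, smul_add]
        abel
      · intro r x h
        simp only [map_smul, LinearMap.smul_apply, h, smul_add, smul_comm r]
    · simp
    · intro x y h1 h2
      simp only [map_add, LinearMap.add_apply, h1, h2, smul_add]
      abel
    · intro r x h
      simp only [map_smul, LinearMap.smul_apply, h, smul_add, smul_comm r]

/-- The indices of the basis `L_m` (`m ≥ 0`), `G_m` (`m ≥ 1`), `C` of the subalgebra `B`. -/
def borelIndex : RamondIndex → Prop
  | .L m => 0 ≤ m
  | .G m => 0 < m
  | .C => True

/-- The span of `L_m`, `G_m` for `m > 0`, together with `L_0` and `C`. -/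
noncomputable def borelSubmodule : Submodule ℂ Ramond :=
  Submodule.span ℂ {x | ∃ a, borelIndex a ∧ x = Finsupp.single a 1}

theorem basisBracket_mem_borel {a b : RamondIndex} (ha : borelIndex a) (hb : borelIndex b) :
    basisBracket a b ∈ borelSubmodule := by
  have h : ∀ c, borelIndex c → (Finsupp.single c 1 : Ramond) ∈ borelSubmodule :=
    fun c hc => Submodule.subset_span ⟨c, hc, rfl⟩
  have hC : C ∈ borelSubmodule := h .C trivial
  rcases a with m | m | _ <;> rcases b with n | n | _ <;>
    simp only [basisBracket, zero_mem] <;> simp only [borelIndex] at ha hb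
  · exact add_mem (Submodule.smul_mem _ _ (h (.L _) (add_nonneg ha hb))) (Submodule.smul_mem _ _ hC)
  · exact Submodule.smul_mem _ _ (h (.G _) (add_pos_of_nonneg_of_pos ha hb))
  · exact neg_mem (Submodule.smul_mem _ _ (h (.G _) (add_pos_of_nonneg_of_pos hb ha)))
  · exact add_mem (Submodule.smul_mem _ _ (h (.L _) (add_pos ha hb).le))
      (Submodule.smul_mem _ _ hC)

/-- The subalgebra `B = R₊ ⊕ ℂ L_0 ⊕ ℂ C` of the Ramond algebra, where `R₊` is the span of the
`L_m` and `G_m` with `m > 0`. -/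
noncomputable def borel : LieSubSuperalgebra Ramond where
  toSubmodule := borelSubmodule
  graded := by
    rw [IsGradedSubspace, borelSubmodule, Submodule.span_le]
    rintro _ ⟨a, ha, rfl⟩
    have h1 : (Finsupp.single a 1 : Ramond) ∈ borelSubmodule := Submodule.subset_span ⟨a, ha, rfl⟩
    have h2 := single_mem_part a
    cases a
    exacts [Submodule.mem_sup_left ⟨h1, h2⟩, Submodule.mem_sup_right ⟨h1, h2⟩,
      Submodule.mem_sup_left ⟨h1, h2⟩]
  bracket_mem {x y} hx hy := by
    change bracket x y ∈ borelSubmodule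
    induction hx using Submodule.span_induction with
    | zero => rw [map_zero]; exact zero_mem _
    | add _ _ _ _ h1 h2 => rw [map_add]; exact add_mem h1 h2
    | smul r _ _ h => rw [map_smul]; exact Submodule.smul_mem _ _ h
    | mem _ hx =>
      obtain ⟨a, ha, rfl⟩ := hx
      induction hy using Submodule.span_induction with
      | zero => rw [map_zero]; exact zero_mem _
      | add _ _ _ _ h1 h2 => rw [map_add]; exact add_mem h1 h2
      | smul r _ _ h => rw [map_smul]; exact Submodule.smul_mem _ _ h
      | mem _ hy =>
        obtain ⟨b, hb, rfl⟩ := hy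
        rw [bracket_single]
        exact basisBracket_mem_borel ha hb

/-- The homogeneous component `R_m`, the span of `L_m`, `G_m` and `δ_{m,0} C`. -/
noncomputable def degreePart (m : ℤ) : Submodule ℂ Ramond :=
  Submodule.span ℂ {L m, G m, (if m = 0 then (1 : ℂ) else 0) • C}

variable {P : Type*} [AddCommGroup P] [Module ℂ P]

/-- A restricted module: every vector is killed by `R_m` for all sufficiently large `m`. -/
def IsRestricted (ρ : SuperModule Ramond P) : Prop :=
  ∀ v : P, ∃ k : ℕ, ∀ m : ℤ, (k : ℤ) < m → ∀ x ∈ degreePart m, ρ.act x v = 0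

/-- The space `M_b = {w ∈ P | L_m w = G_n w = 0 for all m > b, n > b - 1}`. -/
def annihilated (ρ : SuperModule Ramond P) (b : ℤ) : Submodule ℂ P where
  carrier := {w | (∀ m : ℤ, b < m → ρ.act (L m) w = 0) ∧
    ∀ n : ℤ, b - 1 < n → ρ.act (G n) w = 0}
  zero_mem' := ⟨fun _ _ => map_zero _, fun _ _ => map_zero _⟩
  add_mem' hv hw := ⟨fun m hm => by rw [map_add, hv.1 m hm, hw.1 m hm, add_zero],
    fun n hn => by rw [map_add, hv.2 n hn, hw.2 n hn, add_zero]⟩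
  smul_mem' r _ hv := ⟨fun m hm => by rw [map_smul, hv.1 m hm, smul_zero],
    fun n hn => by rw [map_smul, hv.2 n hn, smul_zero]⟩

end Ramond

/-! Outside `B` there is one basis element `z_m` of each weight `m ≥ 1`: `z_{2j} = L_{-j}` and
`z_{2j+1} = G_{-j}`. Facing them are the elements `y_{2j} = L_{b+j}` and `y_{2j+1} = G_{b+j}`
(`lowering`). On `V = M_b` the element `y_0 = L_b` acts as an endomorphism, `y_s` is zero for `s >
0`, and `[y_s, z_s]` is a nonzero multiple of `L_b` (`exists_basisBracket_lowering_self`). So the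
`z_s` and `y_s` behave like creation and annihilation operators, with `L_b` in the role of the
scalar; the argument works when `L_b` is injective on `V`, which for `b = k` is the given
injectivity of `L_k`.

Independence: in a combination of normally ordered monomials of total weight `w`, let `s` be the
smallest index that occurs. Modulo weight below `w - s`, `y_s` deletes one factor `z_s`, multiplies
by its multiplicity and a nonzero constant, and applies `L_b` to the coefficient; monomials without
`z_s` disappear (`lowering_sub_mem_of_le`). Induction on `w` shows that all coefficients vanish
(`eq_zero_of_sum_mem`).

Spanning: straightening along the length filtration shows that the normally ordered monomials
applied to a `B`-stable subspace span a stable subspace (`IsBorelStable.filtration_le_normalSpan`,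
`IsBorelStable.act_mem_normalSpan`).

Hence every vector of `P` has a unique normal form over `V`. A nonzero graded `B`-submodule `W` of
`V` also yields normal forms for all of `P`; for `v ∈ V` uniqueness forces the form to be `v`
itself, so `v ∈ W`. The map `u ⊗ v ↦ u v` from the induced module is onto by simplicity of `P`, and
injective because it sends spanning monomials to independent ones; linear independence inside `U(R)`
is never needed. That `C` is a scalar is Schur's lemma in countable dimension. -/

namespace Ramond

/-! ### Weights of basis elements and of their brackets. -/

/-- The weight of a basis element: `-2m` for `L_m`, `1 - 2m` for `G_m`, and `0` for `C`. It is
positive exactly on the basis elements outside the subalgebra `B`. -/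
def weight : RamondIndex → ℤ
  | .L m => -2 * m
  | .G m => 1 - 2 * m
  | .C => 0

theorem borelIndex_iff_weight_nonpos (a : RamondIndex) : borelIndex a ↔ weight a ≤ 0 := by
  cases a <;> simp only [borelIndex, weight] <;> first | omega | simp

/-- The basis element of weight `m`. -/
def ofWeight (m : ℕ) : RamondIndex :=
  if m % 2 = 0 then .L (-(m / 2 : ℕ)) else .G (-(m / 2 : ℕ))

theorem weight_ofWeight (m : ℕ) : weight (ofWeight m) = m := by
  unfold ofWeight
  split_ifs <;> simp only [weight] <;> omega

theorem ofWeight_weight {a : RamondIndex} (h : 0 < weight a) : ofWeight (weight a).toNat = a := by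
  generalize hw : weight a = w at h ⊢
  cases a <;> simp only [weight] at hw <;> unfold ofWeight
  · rw [if_pos (by omega), RamondIndex.L.injEq]
    omega
  · rw [if_neg (by omega), RamondIndex.G.injEq]
    omega
  · omega

/-- The basis element that lowers the weight by `s` on the modules induced from a `B`-module which
is killed by `L_m` for `m > b` and by `G_n` for `n ≥ b`. -/
def lowering (b : ℤ) (s : ℕ) : RamondIndex :=
  if s % 2 = 0 then .L (b + (s / 2 : ℕ)) else .G (b + (s / 2 : ℕ))

theorem weight_lowering_le {b : ℤ} (hb : 2 ≤ b) (s : ℕ) : weight (lowering b s) ≤ -s - 2 := by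
  unfold lowering
  split_ifs <;> simp only [weight] <;> omega

/-- A basis element, as an element of the Ramond algebra. -/
noncomputable abbrev basisVec (a : RamondIndex) : Ramond := Finsupp.single a 1

theorem basisVec_mem_part (a : RamondIndex) :
    basisVec a ∈ LieSuperalgebra.part (𝔤 := Ramond) (parity a) :=
  single_mem_part a

/-- Weights add in `[L, L]` and `[L, G]` and drop by `2` in `[G, G]`. A central term needs weight
sum `0` or `2`, so `C`, of weight `0`, stays within the bound. -/
theorem basisBracket_mem_span_weight (a b : RamondIndex) :
    basisBracket a b ∈
      Submodule.span ℂ (basisVec '' {c | weight c ≤ weight a + weight b}) := by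
  have h : ∀ c, weight c ≤ weight a + weight b → basisVec c ∈
      Submodule.span ℂ (basisVec '' {c | weight c ≤ weight a + weight b}) :=
    fun c hc => Submodule.subset_span ⟨c, hc, rfl⟩
  have hC : weight a + weight b = 0 ∨ weight a + weight b = 2 → ∀ r : ℂ, r • C ∈
      Submodule.span ℂ (basisVec '' {c | weight c ≤ weight a + weight b}) :=
    fun hc r => Submodule.smul_mem _ _ (h .C (by change 0 ≤ weight a + weight b; omega))
  rcases a with m | m | _ <;> rcases b with n | n | _ <;>
    simp only [basisBracket, zero_mem]
  · refine add_mem (Submodule.smul_mem _ _ (h (.L _) (by simp only [weight]; omega))) ?_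
    split_ifs with h0
    · exact hC (Or.inl (by simp only [weight]; omega)) _
    · simp
  · exact Submodule.smul_mem _ _ (h (.G _) (by simp only [weight]; omega))
  · exact neg_mem (Submodule.smul_mem _ _ (h (.G _) (by simp only [weight]; omega)))
  · refine add_mem (Submodule.smul_mem _ _ (h (.L _) (by simp only [weight]; omega))) ?_
    split_ifs with h0
    · exact hC (Or.inr (by simp only [weight]; omega)) _
    · simp

theorem basisBracket_lowering_mem {b : ℤ} (hb : 2 ≤ b) {s m : ℕ} (h : m ≤ s) :
    basisBracket (lowering b s) (ofWeight m) ∈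
      Submodule.span ℂ (basisVec '' (lowering b '' {t | s - m ≤ t})) := by
  have key : ∀ c t, lowering b t = c → s - m ≤ t → basisVec c ∈
      Submodule.span ℂ (basisVec '' (lowering b '' {t | s - m ≤ t})) := by
    rintro _ t rfl ht
    exact Submodule.subset_span ⟨_, ⟨t, ht, rfl⟩, rfl⟩
  unfold ofWeight
  rw [lowering]
  split_ifs with h1 h2 h2 <;> simp only [basisBracket]
  · rw [if_neg (by omega), zero_smul, add_zero]
    refine Submodule.smul_mem _ _ (key (.L _) (s - m) ?_ le_rfl)
    rw [lowering, if_pos (by omega)]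
    congr 1
    omega
  -- `lowering b t` has weight `-2b - t` for even `t` but `2 - 2b - t` for odd `t`; passing from
  -- even `s` to an odd index therefore gains `2`.
  · refine Submodule.smul_mem _ _ (key (.G _) (s - m + 2) ?_ (by omega))
    rw [lowering, if_neg (by omega)]
    congr 1
    omega
  · refine neg_mem (Submodule.smul_mem _ _ (key (.G _) (s - m) ?_ le_rfl))
    rw [lowering, if_neg (by omega)]
    congr 1
    omega
  · rw [if_neg (by omega), zero_smul, add_zero]
    refine Submodule.smul_mem _ _ (key (.L _) (s - m) ?_ le_rfl)
    rw [lowering, if_pos (by omega)]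
    congr 1
    omega

/-- The constant is `-(b + s)` for even `s` and `-2` for odd `s`. This pairing turns injectivity of
`L_b` into linear independence. -/
theorem exists_basisBracket_lowering_self {b : ℤ} (hb : 2 ≤ b) (s : ℕ) (hs : 0 < s) :
    ∃ r : ℂ, r ≠ 0 ∧ basisBracket (lowering b s) (ofWeight s) = r • L b := by
  unfold ofWeight lowering
  split_ifs with h1 <;> simp only [basisBracket]
  · refine ⟨_, ?_, by rw [if_neg (by omega), zero_smul, add_zero]; congr 2; omega⟩
    have : ((-(s / 2 : ℕ) - (b + (s / 2 : ℕ)) : ℤ) : ℂ) ≠ 0 := by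
      rw [Int.cast_ne_zero]
      omega
    exact_mod_cast this
  · exact ⟨-2, by norm_num, by rw [if_neg (by omega), zero_smul, add_zero]; congr 2; omega⟩

theorem basisVec_lowering_zero (b : ℤ) : basisVec (lowering b 0) = L b := by
  simp [lowering, L]

theorem parity_lowering_zero (b : ℤ) : parity (lowering b 0) = 0 := by
  simp [lowering, parity]

end Ramond

/-! ### Filtrations of a module by weight or by length of monomials. -/

namespace SuperModule

open Ramond

variable {M : Type*} [AddCommGroup M] [Module ℂ M] (ρ : SuperModule Ramond M)

/-- The action of a basis element of the Ramond algebra. -/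
noncomputable def op (a : RamondIndex) : Module.End ℂ M := ρ.act (basisVec a)

theorem op_op (a b : RamondIndex) (v : M) :
    ρ.op a (ρ.op b v) = koszulSign (parity a) (parity b) • ρ.op b (ρ.op a v) +
      ρ.act (basisBracket a b) v := by
  have h := ρ.act_bracket (basisVec_mem_part a) (basisVec_mem_part b) v
  rw [sub_eq_iff_eq_add, add_comm] at h
  rw [← bracket_single]
  exact h

theorem act_mem_of_mem_span {N : Submodule ℂ M} {s : Set RamondIndex} {x : Ramond}
    (hx : x ∈ Submodule.span ℂ (basisVec '' s)) {v : M} (h : ∀ a ∈ s, ρ.op a v ∈ N) :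
    ρ.act x v ∈ N := by
  have : Submodule.span ℂ (basisVec '' s) ≤ N.comap (ρ.act.flip v) := by
    rw [Submodule.span_le]
    rintro _ ⟨a, ha, rfl⟩
    exact h a ha
  exact this hx

theorem act_mem_of_forall_op_mem {N : Submodule ℂ M} {v : M} (h : ∀ a, ρ.op a v ∈ N) (x : Ramond) :
    ρ.act x v ∈ N := by
  refine ρ.act_mem_of_mem_span (s := Set.univ) ?_ fun a _ => h a
  induction x using Finsupp.induction_linear with
  | zero => exact zero_mem _
  | add x y hx hy => exact add_mem hx hy
  | single a r =>
    rw [← mul_one r, ← smul_eq_mul, ← Finsupp.smul_single]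
    exact Submodule.smul_mem _ _ (Submodule.subset_span ⟨a, trivial, rfl⟩)

/-- The operator `z_{m₁} ⋯ z_{mₙ}` where `z_m` is the basis element of weight `m`. -/
noncomputable def monomial (l : List ℕ) : Module.End ℂ M :=
  (l.map fun m => ρ.op (ofWeight m)).prod

@[simp]
theorem monomial_nil (v : M) : ρ.monomial [] v = v := rfl

@[simp]
theorem monomial_cons (m : ℕ) (l : List ℕ) (v : M) :
    ρ.monomial (m :: l) v = ρ.op (ofWeight m) (ρ.monomial l v) := by
  simp [monomial]

/-- The span of the `z_{m₁} ⋯ z_{mₙ} v` with `v ∈ V`, all `mᵢ` positive, and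
`c m₁ + ⋯ + c mₙ ≤ w`. -/
noncomputable def filtration (V : Submodule ℂ M) (c : ℕ → ℕ) (w : ℤ) : Submodule ℂ M :=
  Submodule.span ℂ {x | ∃ (l : List ℕ) (v : M), (∀ m ∈ l, 0 < m) ∧ ((l.map c).sum : ℤ) ≤ w ∧
    v ∈ V ∧ x = ρ.monomial l v}

variable {ρ} {V : Submodule ℂ M} {c : ℕ → ℕ}

theorem monomial_mem_filtration {l : List ℕ} (hl : ∀ m ∈ l, 0 < m) {w : ℤ}
    (hw : ((l.map c).sum : ℤ) ≤ w) {v : M} (hv : v ∈ V) :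
    ρ.monomial l v ∈ ρ.filtration V c w :=
  Submodule.subset_span ⟨l, v, hl, hw, hv, rfl⟩

theorem filtration_le_iff {w : ℤ} {N : Submodule ℂ M} :
    ρ.filtration V c w ≤ N ↔ ∀ (l : List ℕ) (v : M), (∀ m ∈ l, 0 < m) →
      ((l.map c).sum : ℤ) ≤ w → v ∈ V → ρ.monomial l v ∈ N := by
  rw [filtration, Submodule.span_le]
  constructor
  · exact fun h l v hl hw hv => h ⟨l, v, hl, hw, hv, rfl⟩
  · rintro h _ ⟨l, v, hl, hw, hv, rfl⟩
    exact h l v hl hw hv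

theorem filtration_mono {w w' : ℤ} (h : w ≤ w') : ρ.filtration V c w ≤ ρ.filtration V c w' :=
  filtration_le_iff.2 fun _ _ hl hw hv => monomial_mem_filtration hl (hw.trans h) hv

theorem filtration_eq_bot {w : ℤ} (h : w < 0) : ρ.filtration V c w = ⊥ := by
  rw [eq_bot_iff, filtration_le_iff]
  intro l v _ hw _
  exact absurd hw (by omega)

theorem op_ofWeight_mem_filtration {w : ℤ} {m : ℕ} (hm : 0 < m) {x : M}
    (hx : x ∈ ρ.filtration V c w) : ρ.op (ofWeight m) x ∈ ρ.filtration V c (w + c m) := by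
  have : ρ.filtration V c w ≤ (ρ.filtration V c (w + c m)).comap (ρ.op (ofWeight m)) := by
    rw [filtration_le_iff]
    intro l v hl hw hv
    rw [Submodule.mem_comap, ← monomial_cons]
    refine monomial_mem_filtration (by simpa [hm] using hl) ?_ hv
    rw [List.map_cons, List.sum_cons, Nat.cast_add]
    omega
  exact this hx

/-- `V` is stable under the subalgebra `B`. -/
def IsBorelStable (ρ : SuperModule Ramond M) (V : Submodule ℂ M) : Prop :=
  ∀ a, weight a ≤ 0 → ∀ v ∈ V, ρ.op a v ∈ V

/-- Moving `a` of weight at most `0` past `z_m` leaves a bracket of weight at most `m`, which by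
monotonicity of `c` costs no more than `z_m` did. Taking `c = id` filters by weight (for
independence), `c = 1` by length (for spanning). -/
theorem IsBorelStable.op_monomial_mem (hV : ρ.IsBorelStable V) (hc : Monotone c) {l : List ℕ}
    (hl : ∀ m ∈ l, 0 < m) {v : M} (hv : v ∈ V) : ∀ a, (weight a ≤ 0 →
      ρ.op a (ρ.monomial l v) ∈ ρ.filtration V c (l.map c).sum) ∧ ∀ t : ℕ, weight a ≤ t →
      ρ.op a (ρ.monomial l v) ∈ ρ.filtration V c ((l.map c).sum + c t) := by
  have pos : ∀ {l : List ℕ}, (∀ m ∈ l, 0 < m) → (∀ a, weight a ≤ 0 →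
      ρ.op a (ρ.monomial l v) ∈ ρ.filtration V c (l.map c).sum) → ∀ a, ∀ t : ℕ, weight a ≤ t →
      ρ.op a (ρ.monomial l v) ∈ ρ.filtration V c ((l.map c).sum + c t) := by
    intro l hl h a t ht
    rcases le_or_gt (weight a) 0 with h0 | h0
    · exact filtration_mono (by omega) (h a h0)
    · rw [← ofWeight_weight h0]
      have := hc (show (weight a).toNat ≤ t by omega)
      exact filtration_mono (by omega) (op_ofWeight_mem_filtration (by omega)
        (monomial_mem_filtration hl le_rfl hv))
  suffices ∀ a, weight a ≤ 0 → ρ.op a (ρ.monomial l v) ∈ ρ.filtration V c (l.map c).sum from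
    fun a => ⟨this a, pos hl this a⟩
  induction l with
  | nil =>
    intro a ha
    exact monomial_mem_filtration (l := []) (by simp) le_rfl (hV a ha v hv)
  | cons m l ih =>
    intro a ha
    have hl' : ∀ m ∈ l, 0 < m := fun n hn => hl n (by simp [hn])
    have ih := ih hl'
    rw [monomial_cons, op_op, List.map_cons, List.sum_cons]
    refine add_mem (Submodule.smul_mem _ _ ?_) ?_
    · exact filtration_mono (by push_cast; omega)
        (op_ofWeight_mem_filtration (hl m (by simp)) (ih a ha))
    · refine ρ.act_mem_of_mem_span (basisBracket_mem_span_weight _ _) fun d hd => ?_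
      have hd : weight d ≤ weight a + weight (ofWeight m) := hd
      rw [weight_ofWeight] at hd
      exact filtration_mono (by push_cast; omega) (pos hl' ih d m (by omega))

theorem IsBorelStable.op_mem_filtration (hV : ρ.IsBorelStable V) (hc : Monotone c) {w : ℤ} {t : ℕ}
    {a : RamondIndex} (ha : weight a ≤ t) {x : M} (hx : x ∈ ρ.filtration V c w) :
    ρ.op a x ∈ ρ.filtration V c (w + c t) := by
  have : ρ.filtration V c w ≤ (ρ.filtration V c (w + c t)).comap (ρ.op a) := by
    rw [filtration_le_iff]
    intro l v hl hw hv
    exact filtration_mono (by omega) ((hV.op_monomial_mem hc hl hv a).2 t ha)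
  exact this hx

end SuperModule

/-! ### Straightening: normally ordered monomials span. -/

namespace SuperModule

open Ramond

variable {M : Type*} [AddCommGroup M] [Module ℂ M] {ρ : SuperModule Ramond M}
  {V : Submodule ℂ M}

/-- The exponent lists of the Poincaré–Birkhoff–Witt monomials: nondecreasing lists of positive
weights in which no odd weight is repeated. -/
def IsNormal (l : List ℕ) : Prop :=
  (∀ m ∈ l, 0 < m) ∧ l.Pairwise fun m n => m < n ∨ m = n ∧ Even m

variable (ρ V) in
/-- The span of the normally ordered monomials applied to `V`. -/
noncomputable def normalSpan : Submodule ℂ M :=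
  Submodule.span ℂ {x | ∃ (l : List ℕ) (v : M), IsNormal l ∧ v ∈ V ∧ x = ρ.monomial l v}

theorem sum_map_one (l : List ℕ) : (l.map fun _ => (1 : ℕ)).sum = l.length := by
  simp

/-- Swapping neighbours replaces two factors by a single bracket, hence costs only shorter terms.
Only spanning is at stake, so the value of `ε` is irrelevant. -/
theorem IsBorelStable.exists_perm_sub_mem (hV : ρ.IsBorelStable V) {l l' : List ℕ}
    (h : l.Perm l') (hl : ∀ m ∈ l, 0 < m) {v : M} (hv : v ∈ V) : ∃ ε : ℂ,
      ρ.monomial l v - ε • ρ.monomial l' v ∈ ρ.filtration V (fun _ => 1) (l.length - 1) := by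
  induction h with
  | nil => exact ⟨1, by simp⟩
  | @cons m l l' h ih =>
    obtain ⟨ε, hε⟩ := ih fun n hn => hl n (by simp [hn])
    refine ⟨ε, ?_⟩
    rw [monomial_cons, monomial_cons, ← map_smul, ← map_sub]
    exact filtration_mono (by rw [List.length_cons]; push_cast; omega)
      (op_ofWeight_mem_filtration (hl m (by simp)) hε)
  | swap m n l =>
    refine ⟨koszulSign (parity (ofWeight n)) (parity (ofWeight m)), ?_⟩
    simp only [monomial_cons]
    rw [op_op, add_sub_cancel_left]
    refine ρ.act_mem_of_mem_span (basisBracket_mem_span_weight _ _) fun a _ => ?_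
    have hl' : ∀ m ∈ l, 0 < m := fun n hn => hl n (by simp [hn])
    refine filtration_mono ?_ (((hV.op_monomial_mem monotone_const hl' hv a).2 _
      (Int.self_le_toNat _)))
    rw [sum_map_one, List.length_cons, List.length_cons]
    push_cast
    omega
  | @trans l₁ l₂ l₃ h h' ih ih' =>
    obtain ⟨ε, hε⟩ := ih hl
    obtain ⟨ε', hε'⟩ := ih' fun n hn => hl n (h.mem_iff.2 hn)
    rw [← h.length_eq] at hε'
    refine ⟨ε * ε', ?_⟩
    have := add_mem hε (Submodule.smul_mem _ ε hε')
    rwa [smul_sub, smul_smul, sub_add_sub_cancel] at this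

/-- A sorted list fails to be normal only through a repeated odd weight, and for odd `z_m` one has
`2 z_m² = [z_m, z_m]`, which is shorter. -/
theorem IsBorelStable.isNormal_or_mem (hV : ρ.IsBorelStable V) {l : List ℕ}
    (hl : ∀ m ∈ l, 0 < m) (hs : l.Pairwise (· ≤ ·)) {v : M} (hv : v ∈ V) :
    IsNormal l ∨ ρ.monomial l v ∈ ρ.filtration V (fun _ => 1) (l.length - 1) := by
  induction l with
  | nil => exact Or.inl ⟨by simp, List.Pairwise.nil⟩
  | cons m l ih =>
    have hl' : ∀ m ∈ l, 0 < m := fun n hn => hl n (by simp [hn])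
    rw [List.pairwise_cons] at hs
    rcases ih hl' hs.2 with h | h
    · by_cases hm : Even m
      · refine Or.inl ⟨hl, List.pairwise_cons.2 ⟨fun n hn => ?_, h.2⟩⟩
        rcases (hs.1 n hn).lt_or_eq with h' | h'
        exacts [Or.inl h', Or.inr ⟨h', hm⟩]
      by_cases hml : m ∈ l
      · right
        obtain ⟨q, rfl⟩ : ∃ q, l = m :: q := by
          cases l with
          | nil => simp at hml
          | cons n q =>
            have h1 := hs.1 n (by simp)
            rcases List.mem_cons.1 hml with rfl | h2
            · exact ⟨q, rfl⟩
            · exact ⟨q, by rw [le_antisymm h1 (List.rel_of_pairwise_cons hs.2 h2)]⟩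
        have hq : ∀ n ∈ q, 0 < n := fun n hn => hl n (by simp [hn])
        have hp : parity (ofWeight m) = 1 := by
          rw [Nat.even_iff] at hm
          rw [ofWeight, if_neg hm]
          rfl
        have h2 := ρ.op_op (ofWeight m) (ofWeight m) (ρ.monomial q v)
        rw [hp, koszulSign, ZMod.val_one, mul_one, pow_one, neg_one_smul, eq_neg_add_iff_add_eq,
          ← two_smul ℂ] at h2
        have h3 : ρ.act (basisBracket (ofWeight m) (ofWeight m)) (ρ.monomial q v) ∈
            ρ.filtration V (fun _ => 1) ((m :: m :: q).length - 1) := by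
          refine ρ.act_mem_of_mem_span (basisBracket_mem_span_weight _ _) fun a _ => ?_
          refine filtration_mono ?_ (((hV.op_monomial_mem monotone_const hq hv a).2 _
            (Int.self_le_toNat _)))
          rw [sum_map_one, List.length_cons, List.length_cons]
          push_cast
          omega
        rw [← h2] at h3
        simp only [monomial_cons]
        exact (Submodule.smul_mem_iff _ (two_ne_zero (α := ℂ))).1 h3
      · refine Or.inl ⟨hl, List.pairwise_cons.2 ⟨fun n hn => Or.inl ?_, h.2⟩⟩
        exact lt_of_le_of_ne (hs.1 n hn) fun h => hml (h ▸ hn)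
    · right
      rw [monomial_cons]
      exact filtration_mono (by rw [List.length_cons]; push_cast; omega)
        (op_ofWeight_mem_filtration (hl m (by simp)) h)

theorem IsBorelStable.filtration_le_normalSpan (hV : ρ.IsBorelStable V) (n : ℕ) :
    ρ.filtration V (fun _ => 1) n ≤ ρ.normalSpan V := by
  induction n using Nat.strong_induction_on with
  | _ n ih =>
    -- At `n = 0` the integer bound is `-1`, where the filtration vanishes.
    have ih' : ρ.filtration V (fun _ => 1) (n - 1) ≤ ρ.normalSpan V := by
      cases n with
      | zero => rw [filtration_eq_bot (by simp)]; exact bot_le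
      | succ n => simpa using ih n (Nat.lt_succ_self n)
    rw [filtration_le_iff]
    intro l v hl hw hv
    rw [sum_map_one] at hw
    have hp : l.Perm (l.insertionSort (· ≤ ·)) := (List.perm_insertionSort _ l).symm
    obtain ⟨ε, hε⟩ := hV.exists_perm_sub_mem hp hl hv
    have h1 := ih' (filtration_mono (by omega) hε)
    rw [← Submodule.add_mem_iff_right _ (neg_mem h1)]
    rw [neg_sub, sub_add_cancel]
    refine Submodule.smul_mem _ _ ?_
    rcases hV.isNormal_or_mem (fun m hm => hl m (hp.mem_iff.2 hm))
      (List.pairwise_insertionSort (· ≤ ·) l) hv with h | h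
    · exact Submodule.subset_span ⟨_, v, h, hv, rfl⟩
    · rw [← hp.length_eq] at h
      exact ih' (filtration_mono (by omega) h)

theorem IsBorelStable.act_mem_normalSpan (hV : ρ.IsBorelStable V) (x : Ramond) {u : M}
    (hu : u ∈ ρ.normalSpan V) : ρ.act x u ∈ ρ.normalSpan V := by
  refine ρ.act_mem_of_forall_op_mem (fun a => ?_) x
  have : ρ.normalSpan V ≤ (ρ.normalSpan V).comap (ρ.op a) := by
    conv_lhs => rw [normalSpan]
    rw [Submodule.span_le]
    rintro _ ⟨l, v, hl, hv, rfl⟩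
    refine hV.filtration_le_normalSpan (l.length + 1) ?_
    refine filtration_mono ?_ (((hV.op_monomial_mem monotone_const hl.1 hv a).2 _
      (Int.self_le_toNat _)))
    rw [sum_map_one]
    push_cast
    rfl
  exact this hu

theorem le_normalSpan : V ≤ ρ.normalSpan V := fun v hv =>
  Submodule.subset_span ⟨[], v, ⟨by simp, List.Pairwise.nil⟩, hv, rfl⟩

/-- Evaluation of a `V`-valued combination of monomials. -/
noncomputable def evalMonomials (ρ : SuperModule Ramond M) : (List ℕ →₀ M) →ₗ[ℂ] M :=
  Finsupp.lsum ℂ ρ.monomial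

theorem evalMonomials_single (l : List ℕ) (v : M) :
    ρ.evalMonomials (Finsupp.single l v) = ρ.monomial l v := by
  simp [evalMonomials]

/-- The combinations of normally ordered monomials with coefficients in `V`. -/
def normalForms (V : Submodule ℂ M) : Submodule ℂ (List ℕ →₀ M) where
  carrier := {f | ∀ l, f l ∈ V ∧ (f l ≠ 0 → IsNormal l)}
  zero_mem' := by simp
  add_mem' {f g} hf hg l := by
    refine ⟨add_mem (hf l).1 (hg l).1, fun h => ?_⟩
    by_cases h0 : f l = 0
    · exact (hg l).2 (by simpa [h0] using h)
    · exact (hf l).2 h0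
  smul_mem' r f hf l :=
    ⟨Submodule.smul_mem _ r (hf l).1, fun h => (hf l).2 fun h0 => h (by simp [h0])⟩

theorem single_mem_normalForms {l : List ℕ} (hl : IsNormal l) {v : M} (hv : v ∈ V) :
    Finsupp.single l v ∈ normalForms V := by
  classical
  intro l'
  rw [Finsupp.single_apply]
  split_ifs with h
  · exact ⟨hv, fun _ => h ▸ hl⟩
  · simp

theorem map_normalForms : (normalForms V).map ρ.evalMonomials = ρ.normalSpan V := by
  apply le_antisymm
  · rintro _ ⟨f, hf, rfl⟩
    rw [evalMonomials, Finsupp.lsum_apply]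
    refine Submodule.sum_mem _ fun l hl => Submodule.subset_span ⟨l, f l, ?_, (hf l).1, rfl⟩
    exact (hf l).2 (Finsupp.mem_support_iff.1 hl)
  · rw [normalSpan, Submodule.span_le]
    rintro _ ⟨l, v, hl, hv, rfl⟩
    exact ⟨_, single_mem_normalForms hl hv, evalMonomials_single l v⟩

end SuperModule

/-! ### Leading terms and linear independence over `V`. -/

namespace SuperModule

open Ramond

variable {M : Type*} [AddCommGroup M] [Module ℂ M] {ρ : SuperModule Ramond M}
  {V : Submodule ℂ M} {b : ℤ}

theorem koszulSign_zero_left (i : ZMod 2) : koszulSign 0 i = 1 := by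
  simp [koszulSign]

/-- `V` is a `B`-stable subspace killed by `L_m` for `m > b` and by `G_n` for `n ≥ b`. -/
structure IsLowestWeight (ρ : SuperModule Ramond M) (V : Submodule ℂ M) (b : ℤ) : Prop where
  two_le : 2 ≤ b
  stable : ρ.IsBorelStable V
  lowering_eq_zero : ∀ s, 0 < s → ∀ v ∈ V, ρ.op (lowering b s) v = 0

namespace IsLowestWeight

theorem lowering_zero_mem (h : ρ.IsLowestWeight V b) {v : M} (hv : v ∈ V) :
    ρ.op (lowering b 0) v ∈ V :=
  h.stable _ (by have := weight_lowering_le h.two_le 0; push_cast at this; omega) v hv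

/-- The expected shift is `m - s`; the gap `weight (lowering b s) ≤ -s - 2`, which comes from `2 ≤
b`, makes the bracket fall strictly below it. This is why such brackets never reach the leading
term. -/
theorem act_basisBracket_mem (h : ρ.IsLowestWeight V b) {s m : ℕ} (hm : s < m) {w : ℤ} {x : M}
    (hx : x ∈ ρ.filtration V id w) :
    ρ.act (basisBracket (lowering b s) (ofWeight m)) x ∈ ρ.filtration V id (w + m - s - 1) := by
  refine ρ.act_mem_of_mem_span (basisBracket_mem_span_weight _ _) fun d hd => ?_
  have hd : weight d ≤ weight (lowering b s) + weight (ofWeight m) := hd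
  rw [weight_ofWeight] at hd
  have := weight_lowering_le h.two_le s
  have h1 := h.stable.op_mem_filtration monotone_id (t := m - s - 1) (a := d) (by omega) hx
  exact filtration_mono (by simp only [id]; omega) h1

/-- The bracket of `y_s` with the first factor `z_m` is a combination of `y_t` with `t ≥ s - m` if
`m ≤ s`, and small by weight if `m > s`. The index `s` varies in the induction for the first case.
-/
theorem lowering_monomial_mem (h : ρ.IsLowestWeight V b) {l : List ℕ} (hl : ∀ m ∈ l, 0 < m)
    {v : M} (hv : v ∈ V) (s : ℕ) :
    ρ.op (lowering b s) (ρ.monomial l v) ∈ ρ.filtration V id (l.sum - s) := by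
  induction l generalizing s with
  | nil =>
    rcases Nat.eq_zero_or_pos s with rfl | hs
    · exact monomial_mem_filtration (l := []) (by simp) (by simp) (h.lowering_zero_mem hv)
    · rw [monomial_nil, h.lowering_eq_zero s hs v hv]
      exact zero_mem _
  | cons m l ih =>
    have hl' : ∀ m ∈ l, 0 < m := fun n hn => hl n (by simp [hn])
    rw [monomial_cons, op_op, List.sum_cons]
    refine add_mem (Submodule.smul_mem _ _ ?_) ?_
    · exact filtration_mono (by simp only [id]; push_cast; omega)
        (op_ofWeight_mem_filtration (hl m (by simp)) (ih hl' s))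
    · rcases le_or_gt m s with hm | hm
      · refine ρ.act_mem_of_mem_span (basisBracket_lowering_mem h.two_le hm) ?_
        rintro _ ⟨t, ht, rfl⟩
        have ht : s - m ≤ t := ht
        exact filtration_mono (by push_cast; omega) (ih hl' t)
      · refine filtration_mono ?_ (h.act_basisBracket_mem hm
          (monomial_mem_filtration hl' le_rfl hv))
        rw [List.map_id]
        push_cast
        omega

theorem lowering_mem (h : ρ.IsLowestWeight V b) (s : ℕ) {w : ℤ} {x : M}
    (hx : x ∈ ρ.filtration V id w) :
    ρ.op (lowering b s) x ∈ ρ.filtration V id (w - s) := by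
  have : ρ.filtration V id w ≤ (ρ.filtration V id (w - s)).comap (ρ.op (lowering b s)) := by
    rw [filtration_le_iff]
    intro l v hl hw hv
    rw [List.map_id] at hw
    exact filtration_mono (by omega) (h.lowering_monomial_mem hl hv s)
  exact this hx

/-- When all factors have weight above `s`, every bracket met on the way to `v` is of lower order,
so `y_s` supercommutes with the monomial to leading order. -/
theorem exists_lowering_sub_mem (h : ρ.IsLowestWeight V b) {s : ℕ} {l : List ℕ}
    (hl : ∀ m ∈ l, s < m) {v : M} (hv : v ∈ V) : ∃ ε : ℂ, (s = 0 → ε = 1) ∧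
      ρ.op (lowering b s) (ρ.monomial l v) - ε • ρ.monomial l (ρ.op (lowering b s) v) ∈
        ρ.filtration V id (l.sum - s - 1) := by
  induction l with
  | nil => exact ⟨1, by simp⟩
  | cons m l ih =>
    obtain ⟨ε, h0, hε⟩ := ih fun n hn => hl n (by simp [hn])
    have hm := hl m (by simp)
    refine ⟨koszulSign (parity (lowering b s)) (parity (ofWeight m)) * ε, ?_, ?_⟩
    · rintro rfl
      rw [parity_lowering_zero, koszulSign_zero_left, one_mul, h0 rfl]
    · rw [monomial_cons, monomial_cons, op_op, add_sub_right_comm, mul_smul, ← smul_sub,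
        ← map_smul, ← map_sub, List.sum_cons]
      refine add_mem (Submodule.smul_mem _ _ ?_) ?_
      · exact filtration_mono (by simp only [id]; push_cast; omega)
          (op_ofWeight_mem_filtration (by omega) hε)
      · refine filtration_mono ?_ (h.act_basisBracket_mem hm (monomial_mem_filtration
          (fun n hn => (Nat.zero_le s).trans_lt (hl n (by simp [hn]))) le_rfl hv))
        rw [List.map_id]
        push_cast
        omega

theorem lowering_mem_of_lt (h : ρ.IsLowestWeight V b) {s : ℕ} (hs : 0 < s) {l : List ℕ}
    (hl : ∀ m ∈ l, s < m) {v : M} (hv : v ∈ V) :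
    ρ.op (lowering b s) (ρ.monomial l v) ∈ ρ.filtration V id (l.sum - s - 1) := by
  obtain ⟨ε, -, hε⟩ := h.exists_lowering_sub_mem hl hv
  simpa only [h.lowering_eq_zero s hs v hv, map_zero, smul_zero, sub_zero] using hε

theorem lowering_zero_sub_mem (h : ρ.IsLowestWeight V b) {l : List ℕ} (hl : ∀ m ∈ l, 0 < m)
    {v : M} (hv : v ∈ V) :
    ρ.op (lowering b 0) (ρ.monomial l v) - ρ.monomial l (ρ.op (lowering b 0) v) ∈
      ρ.filtration V id (l.sum - 1) := by
  obtain ⟨ε, h0, hε⟩ := h.exists_lowering_sub_mem hl hv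
  simpa only [h0 rfl, one_smul, Nat.cast_zero, sub_zero] using hε

theorem _root_.SuperModule.IsNormal.tail {m : ℕ} {l : List ℕ} (hl : IsNormal (m :: l)) :
    IsNormal l :=
  ⟨fun n hn => hl.1 n (by simp [hn]), (List.pairwise_cons.1 hl.2).2⟩

theorem _root_.SuperModule.IsNormal.eq_cons_erase {s : ℕ} {l : List ℕ} (hl : IsNormal l)
    (hs : ∀ m ∈ l, s ≤ m) (h : s ∈ l) : l = s :: l.erase s := by
  cases l with
  | nil => simp at h
  | cons m l =>
    have : m = s := by
      rcases List.mem_cons.1 h with rfl | h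
      · rfl
      · have h1 := (List.pairwise_cons.1 hl.2).1 s h
        have h2 := hs m (by simp)
        omega
    rw [this, List.erase_cons_head]

/-- To leading order `y_s` acts as `r L_b ∂/∂z_s`: each factor `z_s` contributes its bracket `r
L_b`, which then passes through to `v`. -/
theorem lowering_sub_mem_of_le (h : ρ.IsLowestWeight V b) {s : ℕ} (hs : 0 < s) {r : ℂ}
    (hr : basisBracket (lowering b s) (ofWeight s) = r • L b) {l : List ℕ} (hl : IsNormal l)
    (hsl : ∀ m ∈ l, s ≤ m) {v : M} (hv : v ∈ V) :
    ρ.op (lowering b s) (ρ.monomial l v) -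
      (l.count s * r) • ρ.monomial (l.erase s) (ρ.op (lowering b 0) v) ∈
        ρ.filtration V id (l.sum - s - 1) := by
  induction l with
  | nil => simp [h.lowering_eq_zero s hs v hv]
  | cons m l ih =>
    rcases (hsl m (by simp)).lt_or_eq with hm | rfl
    · have hm' : ∀ n ∈ m :: l, s < n := by
        intro n hn
        rcases List.mem_cons.1 hn with rfl | hn
        · exact hm
        · have := (List.pairwise_cons.1 hl.2).1 n hn
          omega
      rw [List.count_eq_zero_of_not_mem fun h => (hm' s h).false, Nat.cast_zero, zero_mul,
        zero_smul, sub_zero]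
      exact h.lowering_mem_of_lt hs hm' hv
    · have hl' := hl.tail
      have hsl' : ∀ m ∈ l, s ≤ m := fun n hn => hsl n (by simp [hn])
      have h1 := h.lowering_zero_sub_mem hl'.1 hv
      have h2 : ∃ y ∈ ρ.filtration V id (l.sum - 1),
          koszulSign (parity (lowering b s)) (parity (ofWeight s)) •
            ρ.op (ofWeight s) (ρ.op (lowering b s) (ρ.monomial l v)) =
          (l.count s * r) • ρ.monomial l (ρ.op (lowering b 0) v) + y := by
        -- For even `s`, `y_s` is even and the contributions of repeated `z_s` add up without signs.
        -- For odd `s`, normality forbids a second `z_s`, so no sign matters.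
        by_cases hsp : Even s
        · have h3 := ih hl' hsl'
          have h4 := op_ofWeight_mem_filtration hs h3
          refine ⟨_, filtration_mono (by simp only [id]; omega) h4, ?_⟩
          have h5 : parity (lowering b s) = 0 := by
            rw [Nat.even_iff] at hsp
            rw [lowering, if_pos hsp]
            rfl
          rw [h5, koszulSign_zero_left, one_smul, map_sub, map_smul, ← monomial_cons]
          by_cases hmem : s ∈ l
          · rw [← hl'.eq_cons_erase hsl' hmem]
            abel
          · rw [List.count_eq_zero_of_not_mem hmem]
            simp
        · have hlt : ∀ n ∈ l, s < n := by
            intro n hn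
            rcases (List.pairwise_cons.1 hl.2).1 n hn with h | h
            exacts [h, absurd h.2 hsp]
          have h4 := op_ofWeight_mem_filtration hs (h.lowering_mem_of_lt hs hlt hv)
          refine ⟨koszulSign (parity (lowering b s)) (parity (ofWeight s)) •
            ρ.op (ofWeight s) (ρ.op (lowering b s) (ρ.monomial l v)), Submodule.smul_mem _ _
              (filtration_mono (by simp only [id]; omega) h4), ?_⟩
          rw [List.count_eq_zero_of_not_mem fun h => (hlt s h).false]
          simp
      obtain ⟨y, hy, hy'⟩ := h2
      rw [List.erase_cons_head, List.count_cons_self, monomial_cons, op_op, hy', hr, map_smul,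
        LinearMap.smul_apply, ← basisVec_lowering_zero, ← op]
      have h6 := add_mem hy (Submodule.smul_mem _ r h1)
      rw [List.sum_cons, show ((s + l.sum : ℕ) : ℤ) - s - 1 = l.sum - 1 by push_cast; omega]
      convert h6 using 1
      push_cast
      module

theorem eq_zero_of_sum_mem (h : ρ.IsLowestWeight V b)
    (hinj : ∀ v ∈ V, ρ.op (lowering b 0) v = 0 → v = 0) (w : ℕ) :
    ∀ (A : Finset (List ℕ)) (f : List ℕ → M),
      (∀ l ∈ A, IsNormal l ∧ l.sum = w ∧ f l ∈ V) →
      ∑ l ∈ A, ρ.monomial l (f l) ∈ ρ.filtration V id (w - 1) → ∀ l ∈ A, f l = 0 := by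
  classical
  induction w using Nat.strong_induction_on with
  | _ w ih =>
    intro A f hA hsum
    by_contra! hne
    obtain ⟨l₀, hl₀, hf₀⟩ := hne
    obtain ⟨A', hA'⟩ : ∃ A', A' = A.filter (fun l => f l ≠ 0) := ⟨_, rfl⟩
    have hmem : ∀ l ∈ A', l ∈ A ∧ f l ≠ 0 := fun l hl => by simpa [hA'] using hl
    have hsum' : ∑ l ∈ A', ρ.monomial l (f l) ∈ ρ.filtration V id (w - 1) := by
      rw [hA', Finset.sum_filter_of_ne]
      · exact hsum
      · intro l _ h h0
        simp [h0] at h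
    have hl₀' : l₀ ∈ A' := by simp [hA', hl₀, hf₀]
    rcases Nat.eq_zero_or_pos w with rfl | hw
    · have hnil : ∀ l ∈ A, l = [] := by
        intro l hl
        obtain ⟨h1, h2, -⟩ := hA l hl
        rcases l with _ | ⟨m, l⟩
        · rfl
        · have := h1.1 m (by simp)
          rw [List.sum_cons] at h2
          omega
      have hA1 : A' = {[]} := by
        refine Finset.eq_singleton_iff_unique_mem.2 ⟨?_, fun l hl => hnil l (hmem l hl).1⟩
        rwa [← hnil l₀ hl₀]
      rw [hA1, Finset.sum_singleton, filtration_eq_bot (by simp), Submodule.mem_bot] at hsum'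
      exact hf₀ (by rw [hnil l₀ hl₀]; exact hsum')
    · have hex : ∃ s, ∃ l ∈ A', s ∈ l := by
        obtain ⟨-, h2, -⟩ := hA l₀ hl₀
        rcases l₀ with _ | ⟨m, l⟩
        · simp at h2
          omega
        · exact ⟨m, _, hl₀', by simp⟩
      -- Minimality of `s` puts it at the head of each list containing it, and makes the remaining
      -- monomials negligible under `y_s`.
      obtain ⟨s, ⟨l₁, hl₁, hsl₁⟩, hmin⟩ : ∃ s, (∃ l ∈ A', s ∈ l) ∧ ∀ l ∈ A', ∀ m ∈ l, s ≤ m :=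
        ⟨Nat.find hex, Nat.find_spec hex, fun l hl m hm => Nat.find_min' hex ⟨l, hl, hm⟩⟩
      have hs : 0 < s := (hA l₁ (hmem l₁ hl₁).1).1.1 s hsl₁
      obtain ⟨r, hr0, hr⟩ := exists_basisBracket_lowering_self h.two_le s hs
      have hlow := h.lowering_mem s hsum'
      obtain ⟨A₂, hA₂⟩ : ∃ A₂, A₂ = A'.filter (fun l => s ∈ l) := ⟨_, rfl⟩
      have hmem₂ : ∀ l ∈ A₂, l ∈ A' ∧ s ∈ l := fun l hl => by simpa [hA₂] using hl
      have hcons : ∀ l ∈ A₂, l = s :: l.erase s := fun l hl =>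
        (hA l (hmem l (hmem₂ l hl).1).1).1.eq_cons_erase (hmin l (hmem₂ l hl).1) (hmem₂ l hl).2
      have hlead : ∑ l ∈ A₂, ρ.monomial (l.erase s)
          ((l.count s * r) • ρ.op (lowering b 0) (f l)) ∈
          ρ.filtration V id ((w : ℤ) - s - 1) := by
        have h1 : ∑ l ∈ A', (ρ.op (lowering b s) (ρ.monomial l (f l)) -
            (l.count s * r) • ρ.monomial (l.erase s) (ρ.op (lowering b 0) (f l))) ∈
            ρ.filtration V id ((w : ℤ) - s - 1) := by
          refine Submodule.sum_mem _ fun l hl => ?_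
          obtain ⟨h2, h3, h4⟩ := hA l (hmem l hl).1
          rw [← h3]
          exact h.lowering_sub_mem_of_le hs hr h2 (hmin l hl) h4
        rw [Finset.sum_sub_distrib, ← map_sum] at h1
        have h2 := sub_mem (filtration_mono (show (w : ℤ) - 1 - s ≤ w - s - 1 by omega) hlow) h1
        rw [sub_sub_cancel] at h2
        rw [hA₂, Finset.sum_filter_of_ne]
        · simpa only [map_smul] using h2
        · intro l _ h3
          by_contra h4
          exact h3 (by simp [List.count_eq_zero_of_not_mem h4])
      have hsub : ∀ l ∈ A₂, l.sum = s + (l.erase s).sum := fun l hl => by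
        conv_lhs => rw [hcons l hl]
        rw [List.sum_cons]
      have hsw : s ≤ w := by
        have h1 := hsub l₁ (by simp [hA₂, hl₁, hsl₁])
        rw [(hA l₁ (hmem l₁ hl₁).1).2.1] at h1
        omega
      have hinjOn : Set.InjOn (fun l : List ℕ => l.erase s) A₂ := fun l hl l' hl' hll => by
        rw [hcons l hl, hcons l' hl']
        exact congrArg _ hll
      -- Erasing the head `s` is injective on `A₂`, so no two leading terms merge; the new
      -- coefficients are nonzero multiples of `L_b f(l)` and stay in `V`.
      have key := ih (w - s) (by omega) (A₂.image fun l => l.erase s)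
        (fun l => (((s :: l).count s : ℂ) * r) • ρ.op (lowering b 0) (f (s :: l))) ?_ ?_
      · have h1 := key (l₁.erase s)
          (Finset.mem_image_of_mem _ (by simp [hA₂, hl₁, hsl₁]))
        rw [← hcons l₁ (by simp [hA₂, hl₁, hsl₁])] at h1
        have h2 : (l₁.count s : ℂ) ≠ 0 := by
          rw [Nat.cast_ne_zero]
          exact (List.count_pos_iff.2 hsl₁).ne'
        rw [smul_eq_zero_iff_right (mul_ne_zero h2 hr0)] at h1
        exact (hmem l₁ hl₁).2 (hinj _ (hA l₁ (hmem l₁ hl₁).1).2.2 h1)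
      · intro l' hl'
        obtain ⟨l, hl, rfl⟩ := Finset.mem_image.1 hl'
        obtain ⟨h1, h2, h3⟩ := hA l (hmem l (hmem₂ l hl).1).1
        have h4 := hsub l hl
        refine ⟨(hcons l hl ▸ h1 : IsNormal (s :: l.erase s)).tail, by omega, ?_⟩
        simp only [← hcons l hl]
        exact Submodule.smul_mem _ _ (h.lowering_zero_mem h3)
      · rw [Finset.sum_image hinjOn, Nat.cast_sub hsw]
        rwa [Finset.sum_congr rfl fun l hl => by rw [← hcons l hl]]

/-- If `L_b` acts injectively on `V`, then the normally ordered monomials are linearly independent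
over `V`. -/
theorem eq_zero_of_evalMonomials_eq_zero (h : ρ.IsLowestWeight V b)
    (hinj : ∀ v ∈ V, ρ.op (lowering b 0) v = 0 → v = 0) {f : List ℕ →₀ M}
    (hf : f ∈ normalForms V) (h0 : ρ.evalMonomials f = 0) : f = 0 := by
  classical
  by_contra hne
  -- Choosing `l₀` of maximal weight puts the rest of the relation in lower filtration, so the
  -- top-weight part meets the hypothesis of `eq_zero_of_sum_mem`.
  obtain ⟨l₀, hl₀, hmax⟩ := f.support.exists_max_image List.sum
    (Finsupp.support_nonempty_iff.2 hne)
  have h1 : ρ.evalMonomials f = ∑ l ∈ f.support.filter (fun l => l.sum = l₀.sum),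
      ρ.monomial l (f l) + ∑ l ∈ f.support.filter (fun l => ¬ l.sum = l₀.sum),
      ρ.monomial l (f l) := by
    rw [Finset.sum_filter_add_sum_filter_not]
    rfl
  have hn : ∀ l ∈ f.support, IsNormal l := fun l hl => (hf l).2 (Finsupp.mem_support_iff.1 hl)
  refine Finsupp.mem_support_iff.1 hl₀ (h.eq_zero_of_sum_mem hinj l₀.sum
    (f.support.filter fun l => l.sum = l₀.sum) f (fun l hl => ?_) ?_ l₀ (by simpa using hl₀))
  · rw [Finset.mem_filter] at hl
    exact ⟨hn l hl.1, hl.2, (hf l).1⟩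
  · rw [← sub_eq_iff_eq_add.2 h1, h0, zero_sub]
    refine neg_mem (Submodule.sum_mem _ fun l hl => ?_)
    rw [Finset.mem_filter] at hl
    have h2 := hmax l hl.1
    refine monomial_mem_filtration (hn l hl.1).1 ?_ (hf l).1
    rw [List.map_id]
    omega

end IsLowestWeight

end SuperModule

/-! ### Graded kernels and Schur's lemma in countable dimension. -/

section Graded

variable {M : Type*} [AddCommGroup M] [Module ℂ M] {A : ZMod 2 → Submodule ℂ M}

theorem IsGradedSubspace.of_left_mem {N : Submodule ℂ M} (h : IsCompl (A 0) (A 1))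
    (hN : ∀ v ∈ A 0, ∀ w ∈ A 1, v + w ∈ N → v ∈ N) : IsGradedSubspace A N := by
  intro x hx
  have hx' : x ∈ A 0 ⊔ A 1 := by rw [h.sup_eq_top]; trivial
  obtain ⟨v, hv, w, hw, rfl⟩ := Submodule.mem_sup.1 hx'
  have hvN := hN v hv w hw hx
  exact Submodule.add_mem_sup ⟨hvN, hv⟩ ⟨(Submodule.add_mem_iff_right _ hvN).1 hx, hw⟩

theorem IsGradedSubspace.span {s : Set M} (hs : ∀ x ∈ s, ∃ i, x ∈ A i) :
    IsGradedSubspace A (Submodule.span ℂ s) := by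
  refine Submodule.span_le.2 fun x hx => ?_
  obtain ⟨i, hi⟩ := hs x hx
  have hx' := Submodule.subset_span (R := ℂ) hx
  fin_cases i
  exacts [Submodule.mem_sup_left ⟨hx', hi⟩, Submodule.mem_sup_right ⟨hx', hi⟩]

/-- The images of `v` and `w` lie in complementary parts, so they cannot cancel: kernels of
homogeneous maps are graded. -/
theorem eq_zero_of_map_add_eq_zero {M' : Type*} [AddCommGroup M'] [Module ℂ M']
    {A' : ZMod 2 → Submodule ℂ M'} (h : IsCompl (A' 0) (A' 1)) {f : M →ₗ[ℂ] M'} {i : ZMod 2}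
    (hf : ∀ j, ∀ v ∈ A j, f v ∈ A' (i + j)) {v w : M} (hv : v ∈ A 0) (hw : w ∈ A 1)
    (hvw : f (v + w) = 0) : f v = 0 := by
  have h0 := hf 0 v hv
  have h1 := neg_mem (hf 1 w hw)
  rw [map_add, add_eq_zero_iff_eq_neg] at hvw
  rw [← hvw] at h1
  fin_cases i
  exacts [Submodule.disjoint_def.1 h.disjoint _ h0 h1, Submodule.disjoint_def.1 h.disjoint _ h1 h0]

end Graded

/-- An operator on a nonzero complex vector space of countable dimension has nonempty spectrum. -/
theorem spectrum_nonempty_of_rank_le_aleph0 {M : Type*} [AddCommGroup M] [Module ℂ M]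
    [Nontrivial M] (hM : Module.rank ℂ M ≤ Cardinal.aleph0) (T : Module.End ℂ M) :
    (spectrum ℂ T).Nonempty := by
  classical
  by_contra hT
  rw [Set.not_nonempty_iff_eq_empty] at hT
  -- With empty spectrum, spectral mapping makes every nonzero polynomial in `T` invertible. The
  -- vectors `(T - a)⁻¹ v`, `a ∈ ℂ`, are then independent, and there are uncountably many of them.
  have hunit : ∀ p : Polynomial ℂ, p ≠ 0 → IsUnit (Polynomial.aeval T p) := by
    intro p hp
    rcases Nat.eq_zero_or_pos p.natDegree with h0 | h0
    · rw [Polynomial.eq_C_of_natDegree_eq_zero h0] at hp ⊢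
      rw [Polynomial.aeval_C]
      exact (IsUnit.mk0 _ (by simpa using hp)).map _
    · have := spectrum.map_polynomial_aeval_of_degree_pos T p
        (Polynomial.natDegree_pos_iff_degree_pos.1 h0)
      rw [hT, Set.image_empty] at this
      have h1 : (0 : ℂ) ∉ spectrum ℂ (Polynomial.aeval T p) := by rw [this]; simp
      exact not_not.1 fun h => h1 (spectrum.zero_mem ℂ h)
  have hfac : ∀ s : Finset ℂ, ∀ a ∈ s, (∏ μ ∈ s, (Polynomial.X - Polynomial.C μ)) =
      (∏ μ ∈ s.erase a, (Polynomial.X - Polynomial.C μ)) * (Polynomial.X - Polynomial.C a) :=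
    fun s a ha => (Finset.prod_erase_mul _ _ ha).symm
  obtain ⟨v, hv⟩ := exists_ne (0 : M)
  have hsurj : ∀ a : ℂ, ∃ w : M, Polynomial.aeval T (Polynomial.X - Polynomial.C a) w = v :=
    fun a => ((Module.End.isUnit_iff _).1 (hunit _ (Polynomial.X_sub_C_ne_zero a))).2 v
  choose w hw using hsurj
  have hli : LinearIndependent ℂ w := by
    rw [linearIndependent_iff']
    intro s g hg a ha
    by_contra hga
    have h1 := congrArg (Polynomial.aeval T (∏ μ ∈ s, (Polynomial.X - Polynomial.C μ))) hg
    rw [map_sum, map_zero] at h1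
    -- Clearing denominators in the relation gives `q(T) v = 0`; the value of `q` at `a` retains
    -- only the nonzero term of index `a`.
    let q : Polynomial ℂ :=
      ∑ a ∈ s, g a • ∏ μ ∈ s.erase a, (Polynomial.X - Polynomial.C μ)
    have hq : Polynomial.aeval T q v = 0 := by
      rw [← h1, map_sum, LinearMap.sum_apply]
      refine Finset.sum_congr rfl fun a ha => ?_
      rw [hfac s a ha, map_smul, map_smul, map_mul, Module.End.mul_apply, hw,
        LinearMap.smul_apply]
    have hq0 : q ≠ 0 := by
      intro h0
      have h2 : q.eval a = g a * ∏ μ ∈ s.erase a, (a - μ) := by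
        rw [Polynomial.eval_finsetSum, Finset.sum_eq_single a]
        · simp [Polynomial.eval_prod]
        · intro c hc hca
          rw [Polynomial.eval_smul, Polynomial.eval_prod,
            Finset.prod_eq_zero (Finset.mem_erase.2 ⟨hca.symm, ha⟩) (by simp), smul_zero]
        · exact fun h => absurd ha h
      rw [h0, Polynomial.eval_zero, eq_comm, mul_eq_zero, Finset.prod_eq_zero_iff] at h2
      rcases h2 with h2 | ⟨μ, hμ, h2⟩
      · exact hga h2
      · exact (Finset.mem_erase.1 hμ).1 (sub_eq_zero.1 h2).symm
    have hinj := ((Module.End.isUnit_iff _).1 (hunit q hq0)).1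
    exact hv (hinj (by rw [hq, map_zero]))
  have h2 := hli.cardinal_lift_le_rank
  have h3 := h2.trans (Cardinal.lift_le.2 hM)
  rw [Cardinal.lift_aleph0, Cardinal.lift_le_aleph0, Cardinal.mk_complex] at h3
  exact absurd h3 (not_le.2 Cardinal.aleph0_lt_continuum)

namespace SuperModule

open Ramond

variable {M : Type*} [AddCommGroup M] [Module ℂ M] {ρ : SuperModule Ramond M}

instance : Countable RamondIndex := by
  refine (Function.LeftInverse.injective (f := fun a : RamondIndex => (match a with
    | .L m => Sum.inl m
    | .G m => Sum.inr (some m)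
    | .C => Sum.inr none : ℤ ⊕ Option ℤ)) (g := fun x => match x with
    | .inl m => .L m
    | .inr (some m) => .G m
    | .inr none => .C) ?_).countable
  rintro (_ | _ | _) <;> rfl

theorem op_mem_part (a : RamondIndex) {j : ZMod 2} {v : M} (hv : v ∈ ρ.part j) :
    ρ.op a v ∈ ρ.part (parity a + j) :=
  ρ.act_mem (basisVec_mem_part a) hv

theorem IsSimple.exists_homogeneous_ne_zero (h : ρ.IsSimple) : ∃ i, ∃ v ∈ ρ.part i, v ≠ 0 := by
  by_contra! h0
  obtain ⟨v, hv⟩ := @exists_ne M h.nontrivial 0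
  exact hv (IsCompl.hom_induction ρ.isCompl_part (p := fun v => v = 0) h0
    (fun v w hv hw => by rw [hv, hw, add_zero]) v)

/-- Countably many words in the basis elements, applied to one nonzero vector, span a submodule. The
vector is taken homogeneous so that the span is graded. -/
theorem IsSimple.rank_le_aleph0 (h : ρ.IsSimple) : Module.rank ℂ M ≤ Cardinal.aleph0 := by
  obtain ⟨i, v, hv, hv0⟩ := h.exists_homogeneous_ne_zero
  let x : List RamondIndex → M := fun l => (l.map ρ.op).prod v
  have hx : ∀ a l, x (a :: l) = ρ.op a (x l) := fun a l => by simp [x]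
  have hsub : ρ.IsSubmodule (Submodule.span ℂ (Set.range x)) := by
    refine ⟨IsGradedSubspace.span ?_, fun y u hu => ρ.act_mem_of_forall_op_mem (fun a => ?_) y⟩
    · rintro _ ⟨l, rfl⟩
      induction l with
      | nil => exact ⟨i, hv⟩
      | cons a l ih =>
        obtain ⟨j, hj⟩ := ih
        rw [hx]
        exact ⟨_, op_mem_part a hj⟩
    · have : Submodule.span ℂ (Set.range x) ≤
          (Submodule.span ℂ (Set.range x)).comap (ρ.op a) := by
        rw [Submodule.span_le]
        rintro _ ⟨l, rfl⟩
        exact Submodule.subset_span ⟨a :: l, hx a l⟩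
      exact this hu
  have hvx : v ∈ Submodule.span ℂ (Set.range x) := Submodule.subset_span ⟨[], rfl⟩
  have htop : Submodule.span ℂ (Set.range x) = ⊤ := by
    refine (h.eq_bot_or_eq_top _ hsub).resolve_left fun h0 => hv0 ?_
    rwa [h0, Submodule.mem_bot] at hvx
  rw [← rank_top, ← htop]
  exact (rank_span_le _).trans (Cardinal.mk_le_aleph0_iff.2 (Set.countable_range x).to_subtype)

theorem op_C_act (x : Ramond) (v : M) : ρ.op .C (ρ.act x v) = ρ.act x (ρ.op .C v) := by
  have h : ∀ a, ρ.op .C (ρ.op a v) = ρ.op a (ρ.op .C v) := fun a => by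
    rw [op_op, show parity .C = 0 from rfl, koszulSign_zero_left, one_smul]
    simp [basisBracket]
  have : ρ.op .C ∘ₗ ρ.act.flip v = ρ.act.flip (ρ.op .C v) := by
    refine Finsupp.lhom_ext' fun a => LinearMap.ext_ring ?_
    exact h a
  exact LinearMap.congr_fun this x

/-- The central element acts on a simple module as a scalar. -/
theorem IsSimple.exists_act_C_eq_smul (h : ρ.IsSimple) :
    ∃ c : ℂ, ∀ w : M, ρ.act C w = c • w := by
  have := h.nontrivial
  obtain ⟨c, hc⟩ := spectrum_nonempty_of_rank_le_aleph0 h.rank_le_aleph0 (ρ.op .C)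
  let f : Module.End ℂ M := algebraMap ℂ _ c - ρ.op .C
  have hf : ∀ v, f v = c • v - ρ.op .C v := fun v => rfl
  have hfact : ∀ x v, f (ρ.act x v) = ρ.act x (f v) := fun x v => by
    rw [hf, hf, op_C_act, map_sub, map_smul]
  -- `C` is even, so `c - C` has graded kernel and image. Not being invertible, it must be zero by
  -- simplicity.
  have hpart : ∀ j, ∀ v ∈ ρ.part j, f v ∈ ρ.part (0 + j) := fun j v hv =>
    sub_mem (by rw [zero_add]; exact Submodule.smul_mem _ _ hv) (op_mem_part .C hv)
  have hker : ρ.IsSubmodule (LinearMap.ker f) := by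
    refine ⟨IsGradedSubspace.of_left_mem ρ.isCompl_part fun v hv w hw hvw => ?_, fun x v hv => ?_⟩
    · exact eq_zero_of_map_add_eq_zero ρ.isCompl_part hpart hv hw hvw
    · rw [LinearMap.mem_ker] at hv ⊢
      rw [hfact, hv, map_zero]
  have hrange : ρ.IsSubmodule (LinearMap.range f) := by
    refine ⟨?_, ?_⟩
    · rintro _ ⟨v, rfl⟩
      refine IsCompl.hom_induction ρ.isCompl_part (p := fun v => f v ∈ _) ?_ ?_ v
      · intro i v hv
        have h1 := hpart i v hv
        fin_cases i
        exacts [Submodule.mem_sup_left ⟨⟨v, rfl⟩, h1⟩, Submodule.mem_sup_right ⟨⟨v, rfl⟩, h1⟩]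
      · intro v w hv hw
        rw [map_add]
        exact add_mem hv hw
    · rintro x _ ⟨v, rfl⟩
      exact ⟨_, hfact x v⟩
  refine ⟨c, ?_⟩
  rcases h.eq_bot_or_eq_top _ hker with h0 | h0
  · refine absurd ((Module.End.isUnit_iff f).2 ⟨LinearMap.ker_eq_bot.1 h0, ?_⟩) hc
    rw [← LinearMap.range_eq_top]
    refine (h.eq_bot_or_eq_top _ hrange).resolve_left fun h1 => ?_
    rw [LinearMap.range_eq_bot] at h1
    rw [h1, LinearMap.ker_zero] at h0
    exact top_ne_bot h0
  · intro w
    have hw : w ∈ LinearMap.ker f := by rw [h0]; trivial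
    exact (sub_eq_zero.1 hw).symm

end SuperModule

theorem map_symm_eq_of_forall_mem {M M' : Type*} [AddCommGroup M] [Module ℂ M] [AddCommGroup M']
    [Module ℂ M'] {A : ZMod 2 → Submodule ℂ M} {A' : ZMod 2 → Submodule ℂ M'}
    (h : IsCompl (A 0) (A 1)) (h' : IsCompl (A' 0) (A' 1)) (e : M ≃ₗ[ℂ] M')
    (he : ∀ i, ∀ v ∈ A i, e v ∈ A' i) (i : ZMod 2) :
    (A' i).map (e.symm : M' →ₗ[ℂ] M) = A i := by
  apply le_antisymm
  · rintro _ ⟨p, hp, rfl⟩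
    obtain ⟨t, rfl⟩ := e.surjective p
    change e.symm (e t) ∈ A i
    rw [e.symm_apply_apply]
    have ht : t ∈ A 0 ⊔ A 1 := by rw [h.sup_eq_top]; trivial
    obtain ⟨v, hv, w, hw, rfl⟩ := Submodule.mem_sup.1 ht
    have hp' : e (v + w) ∈ A' i := hp
    have hv' := he 0 v hv
    have hw' := he 1 w hw
    rw [map_add] at hp'
    fin_cases i
    · have : e w = 0 := Submodule.disjoint_def.1 h'.disjoint _
        ((Submodule.add_mem_iff_right _ hv').1 hp') hw'
      rw [e.map_eq_zero_iff] at this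
      rw [this, add_zero]
      exact hv
    · have : e v = 0 := Submodule.disjoint_def.1 h'.disjoint _ hv'
        ((Submodule.add_mem_iff_left _ hw').1 hp')
      rw [e.map_eq_zero_iff] at this
      rw [this, zero_add]
      exact hw
  · exact fun v hv => ⟨e v, he i v hv, e.symm_apply_apply v⟩

/-! ### The induced module and its map `u ⊗ v ↦ u v`. -/

section Induced

variable {𝔤 : Type*} [AddCommGroup 𝔤] [Module ℂ 𝔤] [LieSuperalgebra 𝔤]
  (𝔟 : LieSubSuperalgebra 𝔤) {V : Type*} [AddCommGroup V] [Module ℂ V]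
  (σ : SuperModule 𝔟.toSubmodule V)

/-- The map `v ↦ 1 ⊗ v` from `V` to the induced module. -/
noncomputable def indUnit : V →ₗ[ℂ] IndSpace 𝔟 σ :=
  (balancedRel 𝔟 σ).mkQ ∘ₗ TensorProduct.mk ℂ (Enveloping 𝔤) V 1

theorem indUnit_apply (v : V) : indUnit 𝔟 σ v = (balancedRel 𝔟 σ).mkQ (1 ⊗ₜ[ℂ] v) := rfl

theorem ind_act_mk (x : 𝔤) (u : Enveloping 𝔤) (v : V) :
    (SuperModule.ind 𝔟 σ).act x ((balancedRel 𝔟 σ).mkQ (u ⊗ₜ[ℂ] v)) =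
      (balancedRel 𝔟 σ).mkQ ((Enveloping.ι x * u) ⊗ₜ[ℂ] v) :=
  indMul_mk 𝔟 σ _ _ _

theorem ind_act_indUnit (x : 𝔟.toSubmodule) (v : V) :
    (SuperModule.ind 𝔟 σ).act (x : 𝔤) (indUnit 𝔟 σ v) = indUnit 𝔟 σ (σ.act x v) := by
  rw [indUnit_apply, indUnit_apply, ind_act_mk, mul_one, ← sub_eq_zero, ← map_sub,
    Submodule.mkQ_apply, Submodule.Quotient.mk_eq_zero]
  exact Submodule.subset_span ⟨1, Enveloping.ι x, v, by
    rw [one_mul, Enveloping.incl_ι, SuperModule.envAct_ι]⟩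

/-- Since `u ⊗ v = u (1 ⊗ v)`, the image of `V` generates. No grading is asked of `N`, so this
applies to the span of monomials directly. -/
theorem ind_eq_top_of_stable {N : Submodule ℂ (IndSpace 𝔟 σ)}
    (hN : ∀ (x : 𝔤), ∀ t ∈ N, (SuperModule.ind 𝔟 σ).act x t ∈ N)
    (hV : ∀ v, indUnit 𝔟 σ v ∈ N) : N = ⊤ := by
  have hmul : ∀ (u w : Enveloping 𝔤) t, indMulHom 𝔟 σ (u * w) t =
      indMulHom 𝔟 σ u (indMulHom 𝔟 σ w t) := fun u w t => by
    have : indMul 𝔟 σ (u * w) = indMul 𝔟 σ u ∘ₗ indMul 𝔟 σ w := indSpace_ext 𝔟 σ fun a v => by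
      rw [LinearMap.comp_apply]
      simp only [indMul_mk, mul_assoc]
    exact LinearMap.congr_fun this t
  have hone : ∀ t, indMulHom 𝔟 σ 1 t = t := fun t => by
    have : indMul 𝔟 σ 1 = LinearMap.id := indSpace_ext 𝔟 σ fun a v => by
      rw [indMul_mk, one_mul, LinearMap.id_apply]
    exact LinearMap.congr_fun this t
  have hstab : ∀ u : Enveloping 𝔤, ∀ t ∈ N, indMulHom 𝔟 σ u t ∈ N := by
    intro u
    induction u using Enveloping.induction with
    | h0 r =>
      intro t ht
      rw [Algebra.algebraMap_eq_smul_one, map_smul, LinearMap.smul_apply, hone]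
      exact Submodule.smul_mem _ _ ht
    | h1 x => exact hN x
    | hm a b iha ihb =>
      intro t ht
      rw [hmul]
      exact iha _ (ihb t ht)
    | ha a b iha ihb =>
      intro t ht
      rw [map_add]
      exact add_mem (iha t ht) (ihb t ht)
  rw [eq_top_iff]
  rintro t -
  obtain ⟨t, rfl⟩ := Submodule.mkQ_surjective _ t
  induction t using TensorProduct.induction_on with
  | zero => rw [map_zero]; exact zero_mem _
  | add a b iha ihb => rw [map_add]; exact add_mem iha ihb
  | tmul u v =>
    have h1 : indMulHom 𝔟 σ u (indUnit 𝔟 σ v) = (balancedRel 𝔟 σ).mkQ (u ⊗ₜ[ℂ] v) := by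
      rw [indUnit_apply]
      exact (indMul_mk 𝔟 σ _ _ _).trans (by rw [mul_one])
    rw [← h1]
    exact hstab u _ (hV v)

end Induced

section Adjunction

variable {𝔤 : Type*} [AddCommGroup 𝔤] [Module ℂ 𝔤] [LieSuperalgebra 𝔤]
  {M : Type*} [AddCommGroup M] [Module ℂ M] (ρ : SuperModule 𝔤 M) {𝔟 : LieSubSuperalgebra 𝔤}
  {V : Submodule ℂ M} (hV : (ρ.restrict 𝔟).IsSubmodule V)

theorem SuperModule.envAct_incl (x : Enveloping 𝔟.toSubmodule) : ∀ v : V,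
    ρ.envAct (Enveloping.incl 𝔟 x) (v : M) = (((ρ.restrict 𝔟).sub hV).envAct x v : V) := by
  induction x using Enveloping.induction with
  | h0 r => intro v; simp only [AlgHom.commutes, Module.algebraMap_end_apply, Submodule.coe_smul]
  | hm a b iha ihb => intro v; simp only [map_mul, Module.End.mul_apply, ihb, iha]
  | ha a b iha ihb =>
    intro v
    simp only [map_add, LinearMap.add_apply, iha, ihb, Submodule.coe_add]
  | h1 x =>
    intro v
    rw [Enveloping.incl_ι, envAct_ι, envAct_ι]
    rfl

/-- The map `u ⊗ v ↦ u v` from the module induced from a `𝔟`-submodule `V` of `M` to `M`. -/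
noncomputable def indCounit : IndSpace 𝔟 ((ρ.restrict 𝔟).sub hV) →ₗ[ℂ] M :=
  (balancedRel 𝔟 ((ρ.restrict 𝔟).sub hV)).liftQ
    (TensorProduct.lift (LinearMap.compl₂ ρ.envAct.toLinearMap V.subtype)) (by
      rw [balancedRel, Submodule.span_le]
      rintro _ ⟨u, x, v, rfl⟩
      rw [SetLike.mem_coe, LinearMap.mem_ker, map_sub, sub_eq_zero]
      simp [ρ.envAct_incl hV])

theorem indCounit_mk (u : Enveloping 𝔤) (v : V) :
    indCounit ρ hV ((balancedRel 𝔟 ((ρ.restrict 𝔟).sub hV)).mkQ (u ⊗ₜ[ℂ] v)) =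
      ρ.envAct u (v : M) := rfl

theorem indCounit_indUnit (v : V) :
    indCounit ρ hV (indUnit 𝔟 ((ρ.restrict 𝔟).sub hV) v) = v := by
  rw [indUnit_apply, indCounit_mk, map_one, Module.End.one_apply]

theorem indCounit_act (x : 𝔤) (t : IndSpace 𝔟 ((ρ.restrict 𝔟).sub hV)) :
    indCounit ρ hV ((SuperModule.ind 𝔟 ((ρ.restrict 𝔟).sub hV)).act x t) =
      ρ.act x (indCounit ρ hV t) := by
  have : indCounit ρ hV ∘ₗ (SuperModule.ind 𝔟 ((ρ.restrict 𝔟).sub hV)).act x =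
      ρ.act x ∘ₗ indCounit ρ hV := indSpace_ext _ _ fun u v => by
    rw [LinearMap.comp_apply, LinearMap.comp_apply, ind_act_mk, indCounit_mk, indCounit_mk,
      map_mul, Module.End.mul_apply, SuperModule.envAct_ι]
  exact LinearMap.congr_fun this t

theorem SuperModule.envAct_mem_part {i j : ZMod 2} {u : Enveloping 𝔤}
    (hu : u ∈ Enveloping.part 𝔤 i) {v : M} (hv : v ∈ ρ.part j) :
    ρ.envAct u v ∈ ρ.part (i + j) := by
  induction hu using Submodule.span_induction with
  | zero => rw [map_zero]; exact zero_mem _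
  | add a b _ _ iha ihb => rw [map_add]; exact add_mem iha ihb
  | smul r a _ iha => rw [map_smul]; exact Submodule.smul_mem _ _ iha
  | mem u hu =>
    obtain ⟨l, hl, rfl, rfl⟩ := hu
    induction l with
    | nil => simpa using hv
    | cons p l ih =>
      have h1 := hl p (by simp)
      have h2 := ih fun q hq => hl q (by simp [hq])
      rw [List.map_cons, List.map_cons, List.prod_cons, List.sum_cons, map_mul,
        Module.End.mul_apply, envAct_ι, add_assoc]
      exact ρ.act_mem h1 h2

theorem indCounit_mem_part {i : ZMod 2} {t : IndSpace 𝔟 ((ρ.restrict 𝔟).sub hV)}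
    (ht : t ∈ indPart 𝔟 ((ρ.restrict 𝔟).sub hV) i) : indCounit ρ hV t ∈ ρ.part i := by
  induction ht using Submodule.span_induction with
  | zero => rw [map_zero]; exact zero_mem _
  | add a b _ _ iha ihb => rw [map_add]; exact add_mem iha ihb
  | smul r a _ iha => rw [map_smul]; exact Submodule.smul_mem _ _ iha
  | mem t ht =>
    obtain ⟨a, c, u, v, hu, hv, rfl, rfl⟩ := ht
    rw [indCounit_mk]
    exact ρ.envAct_mem_part hu hv

/-- If the map `u ⊗ v ↦ u v` is bijective, then `M` is isomorphic to the induced module. -/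
theorem SuperModule.isomorphic_ind_of_bijective (h : Function.Bijective (indCounit ρ hV)) :
    ρ.Isomorphic (SuperModule.ind 𝔟 ((ρ.restrict 𝔟).sub hV)) := by
  let e := LinearEquiv.ofBijective (indCounit ρ hV) h
  refine ⟨e.symm, fun x v => ?_, map_symm_eq_of_forall_mem (SuperModule.ind 𝔟 _).isCompl_part
    ρ.isCompl_part e fun i t ht => indCounit_mem_part ρ hV ht⟩
  rw [LinearEquiv.symm_apply_eq]
  refine Eq.symm ((indCounit_act ρ hV x _).trans (congrArg _ ?_))
  exact e.apply_symm_apply v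

end Adjunction

/-! ### Simplicity of `V` and the isomorphism with the induced module. -/

namespace SuperModule

open Ramond

variable {M : Type*} [AddCommGroup M] [Module ℂ M] {ρ : SuperModule Ramond M}
  {V : Submodule ℂ M} {b : ℤ}

theorem isSubmodule_restrict_borel_iff : (ρ.restrict borel).IsSubmodule V ↔
    IsGradedSubspace ρ.part V ∧ ρ.IsBorelStable V := by
  constructor
  · refine fun h => ⟨h.graded, fun a ha v hv => ?_⟩
    have hmem : basisVec a ∈ borel.toSubmodule :=
      Submodule.subset_span ⟨a, (borelIndex_iff_weight_nonpos a).2 ha, rfl⟩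
    exact h.stable ⟨_, hmem⟩ v hv
  · rintro ⟨h1, h2⟩
    refine ⟨h1, ?_⟩
    rintro ⟨x, hx⟩ v hv
    refine ρ.act_mem_of_mem_span (s := {a | borelIndex a}) (x := x) ?_ fun a ha =>
      h2 a ((borelIndex_iff_weight_nonpos a).1 ha) v hv
    refine Submodule.span_mono ?_ hx
    rintro _ ⟨a, ha, rfl⟩
    exact ⟨a, ha, rfl⟩

theorem monomial_mem_part (l : List ℕ) {i : ZMod 2} {v : M} (hv : v ∈ ρ.part i) :
    ∃ j, ρ.monomial l v ∈ ρ.part j := by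
  induction l with
  | nil => exact ⟨i, hv⟩
  | cons m l ih =>
    obtain ⟨j, hj⟩ := ih
    rw [monomial_cons]
    exact ⟨_, op_mem_part _ hj⟩

theorem IsBorelStable.isSubmodule_normalSpan (hV : ρ.IsBorelStable V)
    (hg : IsGradedSubspace ρ.part V) : ρ.IsSubmodule (ρ.normalSpan V) := by
  refine ⟨?_, fun x v hv => hV.act_mem_normalSpan x hv⟩
  have key : ∀ l, IsNormal l → ∀ i, ∀ v ∈ V ⊓ ρ.part i, ρ.monomial l v ∈
      (ρ.normalSpan V ⊓ ρ.part 0) ⊔ (ρ.normalSpan V ⊓ ρ.part 1) := by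
    intro l hl i v hv
    have h1 : ρ.monomial l v ∈ ρ.normalSpan V := Submodule.subset_span ⟨l, v, hl, hv.1, rfl⟩
    obtain ⟨j, hj⟩ := monomial_mem_part l hv.2
    fin_cases j
    exacts [Submodule.mem_sup_left ⟨h1, hj⟩, Submodule.mem_sup_right ⟨h1, hj⟩]
  refine Submodule.span_le.2 ?_
  rintro _ ⟨l, v, hl, hv, rfl⟩
  obtain ⟨x, hx, y, hy, rfl⟩ := Submodule.mem_sup.1 (hg hv)
  rw [map_add]
  exact add_mem (key l hl 0 x hx) (key l hl 1 y hy)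

theorem IsSimple.normalSpan_eq_top (h : ρ.IsSimple) (hV : ρ.IsBorelStable V)
    (hg : IsGradedSubspace ρ.part V) (hne : V ≠ ⊥) : ρ.normalSpan V = ⊤ :=
  (h.eq_bot_or_eq_top _ (hV.isSubmodule_normalSpan hg)).resolve_left fun h0 =>
    hne (eq_bot_iff.2 (h0 ▸ le_normalSpan))

namespace IsLowestWeight

/-- A nonzero graded `B`-submodule `W` of `V` generates `M`, so `v ∈ V` has a normal form with
coefficients in `W`. Comparing it with the trivial form of `v`, at the empty monomial, puts `v` in
`W`. -/
theorem isSimple_sub (h : ρ.IsLowestWeight V b)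
    (hinj : ∀ v ∈ V, ρ.op (lowering b 0) v = 0 → v = 0) (hρ : ρ.IsSimple) (hne : V ≠ ⊥)
    (hV : (ρ.restrict borel).IsSubmodule V) : ((ρ.restrict borel).sub hV).IsSimple := by
  refine ⟨Submodule.nontrivial_iff_ne_bot.2 hne, fun W hW => or_iff_not_imp_left.2 fun hW0 => ?_⟩
  have hle : W.map V.subtype ≤ V := Submodule.map_subtype_le V W
  have hsub : (ρ.restrict borel).IsSubmodule (W.map V.subtype) := by
    refine ⟨?_, ?_⟩
    · rintro _ ⟨v, hv, rfl⟩
      obtain ⟨x, hx, y, hy, rfl⟩ := Submodule.mem_sup.1 (hW.graded hv)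
      exact Submodule.mem_sup.2 ⟨x, ⟨⟨x, hx.1, rfl⟩, hx.2⟩, y, ⟨⟨y, hy.1, rfl⟩, hy.2⟩, rfl⟩
    · rintro x _ ⟨v, hv, rfl⟩
      exact ⟨_, hW.stable x v hv, rfl⟩
  rw [isSubmodule_restrict_borel_iff] at hsub
  have htop := hρ.normalSpan_eq_top hsub.2 hsub.1
    (fun h0 => hW0 (Submodule.map_injective_of_injective V.subtype_injective
      (h0.trans (Submodule.map_bot _).symm)))
  rw [eq_top_iff]
  rintro ⟨v, hv⟩ -
  have hmem : v ∈ (normalForms (W.map V.subtype)).map ρ.evalMonomials := by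
    rw [map_normalForms, htop]
    trivial
  obtain ⟨f, hf, hfv⟩ := hmem
  have hf' : f ∈ normalForms V := fun l => ⟨hle (hf l).1, (hf l).2⟩
  have hnil : IsNormal [] := ⟨by simp, List.Pairwise.nil⟩
  have h0 := h.eq_zero_of_evalMonomials_eq_zero hinj
    (sub_mem hf' (single_mem_normalForms hnil hv))
    (by rw [map_sub, hfv, evalMonomials_single, monomial_nil, sub_self])
  have h1 := DFunLike.congr_fun (sub_eq_zero.1 h0) []
  rw [Finsupp.single_eq_same] at h1
  obtain ⟨w, hw, hwv⟩ := (hf []).1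
  rw [h1] at hwv
  exact (Subtype.ext hwv : w = ⟨v, hv⟩) ▸ hw

/-- A kernel element is a combination of normal monomials over `1 ⊗ V`; its image is the same
combination over `V`, so independence in `M` makes all coefficients zero. -/
theorem isomorphic_ind (h : ρ.IsLowestWeight V b)
    (hinj : ∀ v ∈ V, ρ.op (lowering b 0) v = 0 → v = 0) (hρ : ρ.IsSimple) (hne : V ≠ ⊥)
    (hV : (ρ.restrict borel).IsSubmodule V) :
    ρ.Isomorphic (SuperModule.ind borel ((ρ.restrict borel).sub hV)) := by
  obtain ⟨τ, hτ⟩ : ∃ τ, τ = SuperModule.ind borel ((ρ.restrict borel).sub hV) := ⟨_, rfl⟩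
  let V' := LinearMap.range (indUnit borel ((ρ.restrict borel).sub hV))
  have hV' : τ.IsBorelStable V' := by
    rintro a ha _ ⟨v, rfl⟩
    have hmem : basisVec a ∈ borel.toSubmodule :=
      Submodule.subset_span ⟨a, (borelIndex_iff_weight_nonpos a).2 ha, rfl⟩
    rw [hτ]
    exact ⟨_, (ind_act_indUnit borel _ ⟨_, hmem⟩ v).symm⟩
  have hmon : ∀ l t, indCounit ρ hV (τ.monomial l t) = ρ.monomial l (indCounit ρ hV t) := by
    intro l t
    induction l with
    | nil => rfl
    | cons m l ih =>
      rw [monomial_cons, monomial_cons, ← ih, hτ]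
      exact indCounit_act ρ hV _ _
  have heval : ∀ f : List ℕ →₀ IndSpace borel ((ρ.restrict borel).sub hV),
      indCounit ρ hV (τ.evalMonomials f) =
        ρ.evalMonomials (Finsupp.mapRange.linearMap (indCounit ρ hV) f) := by
    intro f
    induction f using Finsupp.induction_linear with
    | zero => simp only [map_zero]
    | add f g hf hg => simp only [map_add, hf, hg]
    | single l t =>
      rw [Finsupp.mapRange.linearMap_apply, Finsupp.mapRange_single, evalMonomials_single,
        evalMonomials_single, hmon]
  refine ρ.isomorphic_ind_of_bijective hV ⟨?_, ?_⟩
  · rw [injective_iff_map_eq_zero]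
    intro t ht
    have htop : τ.normalSpan V' = ⊤ := ind_eq_top_of_stable borel _
      (fun x t ht => hτ ▸ hV'.act_mem_normalSpan x ht) fun v => le_normalSpan ⟨v, rfl⟩
    have hmem : t ∈ (normalForms V').map τ.evalMonomials := by
      rw [map_normalForms, htop]
      trivial
    obtain ⟨f, hf, rfl⟩ := hmem
    rw [heval] at ht
    have h0 := h.eq_zero_of_evalMonomials_eq_zero hinj (fun l => ?_) ht
    · have hf0 : f = 0 := by
        ext l
        have h1 : indCounit ρ hV (f l) = 0 := DFunLike.congr_fun h0 l
        obtain ⟨v, hv⟩ := (hf l).1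
        rw [← hv, indCounit_indUnit] at h1
        rw [← hv, (Subtype.ext h1 : v = 0), map_zero, Finsupp.zero_apply]
      rw [hf0, map_zero]
    · rw [Finsupp.mapRange.linearMap_apply, Finsupp.mapRange_apply]
      obtain ⟨v, hv⟩ := (hf l).1
      refine ⟨?_, fun h1 => (hf l).2 fun h2 => h1 (by rw [h2, map_zero])⟩
      rw [← hv, indCounit_indUnit]
      exact v.2
  · rw [← LinearMap.range_eq_top, eq_top_iff, ← hρ.normalSpan_eq_top h.stable hV.graded hne,
      normalSpan, Submodule.span_le]
    rintro _ ⟨l, v, -, hv, rfl⟩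
    exact ⟨τ.monomial l (indUnit borel _ ⟨v, hv⟩), by rw [hmon, indCounit_indUnit]⟩

end IsLowestWeight

end SuperModule

/-! ### The spaces `M_b` and the conclusion. -/

namespace Ramond

open SuperModule

variable {P : Type*} [AddCommGroup P] [Module ℂ P] {ρ : SuperModule Ramond P} {b : ℤ}

theorem mem_annihilated {w : P} : w ∈ annihilated ρ b ↔
    (∀ m : ℤ, b < m → ρ.op (.L m) w = 0) ∧ ∀ n : ℤ, b - 1 < n → ρ.op (.G n) w = 0 := Iff.rfl

theorem isGradedSubspace_annihilated : IsGradedSubspace ρ.part (annihilated ρ b) := by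
  refine IsGradedSubspace.of_left_mem ρ.isCompl_part fun v hv w hw hvw => ?_
  rw [mem_annihilated] at hvw ⊢
  have key : ∀ a, ρ.op a (v + w) = 0 → ρ.op a v = 0 := fun a =>
    eq_zero_of_map_add_eq_zero ρ.isCompl_part (fun j u hu => op_mem_part a hu) hv hw
  exact ⟨fun m hm => key _ (hvw.1 m hm), fun n hn => key _ (hvw.2 n hn)⟩

/-- Brackets with `B` do not decrease indices. The one tight case is `[G_m, G_n]` with `n ≥ b`: it
must give `L_{m+n}` with `m + n > b`, which holds because `m ≥ 1` in `B`. All index sums here are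
positive, so no central term occurs. -/
theorem isBorelStable_annihilated (hb : 0 ≤ b) : ρ.IsBorelStable (annihilated ρ b) := by
  intro a ha w hw
  rw [mem_annihilated] at hw ⊢
  obtain ⟨hL, hG⟩ := hw
  have hL' : ∀ m : ℤ, b < m → ρ.act (L m) w = 0 := hL
  have hG' : ∀ m : ℤ, b - 1 < m → ρ.act (G m) w = 0 := hG
  rw [← borelIndex_iff_weight_nonpos] at ha
  constructor
  · intro n hn
    rw [op_op, hL n hn, map_zero, smul_zero, zero_add]
    rcases a with m | m | _ <;> simp only [borelIndex] at ha <;> simp only [basisBracket]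
    · rw [if_neg (by omega), zero_smul, add_zero, map_smul, LinearMap.smul_apply,
        hL' _ (by omega), smul_zero]
    · rw [map_smul, LinearMap.smul_apply, hG' _ (by omega), smul_zero]
    · rw [map_zero, LinearMap.zero_apply]
  · intro n hn
    rw [op_op, hG n hn, map_zero, smul_zero, zero_add]
    rcases a with m | m | _ <;> simp only [borelIndex] at ha <;> simp only [basisBracket]
    · rw [map_neg, map_smul, LinearMap.neg_apply, LinearMap.smul_apply, hG' _ (by omega),
        smul_zero, neg_zero]
    · rw [if_neg (by omega), zero_smul, add_zero, map_smul, LinearMap.smul_apply,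
        hL' _ (by omega), smul_zero]
    · rw [map_zero, LinearMap.zero_apply]

theorem isLowestWeight_annihilated (hb : 2 ≤ b) : ρ.IsLowestWeight (annihilated ρ b) b := by
  refine ⟨hb, isBorelStable_annihilated (by omega), fun s hs v hv => ?_⟩
  rw [mem_annihilated] at hv
  unfold lowering
  split_ifs with h
  · exact hv.1 _ (by omega)
  · exact hv.2 _ (by omega)

theorem exists_annihilated_ne_bot [Nontrivial P] (h : IsRestricted ρ) :
    ∃ n : ℕ, ∀ b : ℤ, n < b → annihilated ρ b ≠ ⊥ := by
  obtain ⟨v, hv⟩ := exists_ne (0 : P)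
  obtain ⟨n, hn⟩ := h v
  -- The vanishing of `G_m` is required from `m = b` on, hence the strict `n < b`.
  refine ⟨n, fun b hb h0 => hv ?_⟩
  have hmem : v ∈ annihilated ρ b :=
    ⟨fun m hm => hn m (by omega) _ (Submodule.subset_span (by simp)),
      fun m hm => hn m (by omega) _ (Submodule.subset_span (by simp))⟩
  rwa [h0, Submodule.mem_bot] at hmem

end Ramond

theorem theorem4p2 {P : Type*} [AddCommGroup P] [Module ℂ P] (ρ : SuperModule Ramond P)
    (hsimple : ρ.IsSimple) (hrestricted : Ramond.IsRestricted ρ)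
    (k : ℤ) (hk : 2 ≤ k) (hinj : Function.Injective (ρ.act (Ramond.L k))) :
    (∃ c : ℂ, ∀ w : P, ρ.act Ramond.C w = c • w) ∧
    ∃ b : ℤ, IsLeast {b : ℤ | 2 ≤ b ∧ k ≤ b ∧ Ramond.annihilated ρ b ≠ ⊥} b ∧
      ∃ hV : (ρ.restrict Ramond.borel).IsSubmodule (Ramond.annihilated ρ b),
        (b = k →
          ((ρ.restrict Ramond.borel).sub hV).IsSimple ∧
          ρ.Isomorphic (SuperModule.ind Ramond.borel ((ρ.restrict Ramond.borel).sub hV))) ∧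
        (k < b → Set.InjOn (ρ.act (Ramond.L b)) (Ramond.annihilated ρ b : Set P) →
          ((ρ.restrict Ramond.borel).sub hV).IsSimple ∧
          ρ.Isomorphic (SuperModule.ind Ramond.borel ((ρ.restrict Ramond.borel).sub hV))) := by
  refine ⟨hsimple.exists_act_C_eq_smul, ?_⟩
  have := hsimple.nontrivial
  obtain ⟨n, hn⟩ := Ramond.exists_annihilated_ne_bot hrestricted
  -- Restrictedness makes `M_b` nonzero for all `b > n`, so `max (n + 1) k` is admissible, and `2`
  -- bounds the candidates below.
  obtain ⟨b, ⟨hb, hkb, hne⟩, hmin⟩ := Int.exists_least_of_bdd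
    (P := fun b => 2 ≤ b ∧ k ≤ b ∧ Ramond.annihilated ρ b ≠ ⊥) ⟨2, fun b hb => hb.1⟩
    ⟨max (n + 1) k, by omega, by omega, hn _ (by omega)⟩
  have hV : (ρ.restrict Ramond.borel).IsSubmodule (Ramond.annihilated ρ b) :=
    SuperModule.isSubmodule_restrict_borel_iff.2 ⟨Ramond.isGradedSubspace_annihilated,
      Ramond.isBorelStable_annihilated (by omega)⟩
  have hlow := Ramond.isLowestWeight_annihilated (ρ := ρ) hb
  have key : Set.InjOn (ρ.act (Ramond.L b)) (Ramond.annihilated ρ b : Set P) →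
      ((ρ.restrict Ramond.borel).sub hV).IsSimple ∧
      ρ.Isomorphic (SuperModule.ind Ramond.borel ((ρ.restrict Ramond.borel).sub hV)) := by
    intro h
    have h' : ∀ v ∈ Ramond.annihilated ρ b, ρ.op (Ramond.lowering b 0) v = 0 → v = 0 := by
      intro v hv h0
      rw [SuperModule.op, Ramond.basisVec_lowering_zero] at h0
      exact h hv (zero_mem _) (by rw [h0, map_zero])
    exact ⟨hlow.isSimple_sub h' hsimple hne hV, hlow.isomorphic_ind h' hsimple hne hV⟩
  refine ⟨b, ⟨⟨hb, hkb, hne⟩, fun c hc => hmin c hc⟩, hV, ?_, fun _ => key⟩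
  -- For `b = k`, the injectivity of `L_k` on all of `P` restricts to `V`.
  rintro rfl
  exact key hinj.injOn
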